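/- Let $d,r\ge 0$ be integers and let $|\cdot|$ be the Hermitian norm of $\mathbf C^r$. Fix numbers $\lambda_k>0$, $p_k,\ q_{k,l,m},\ d_k\in[0,1]$ ($k,l,m\in\mathbf Z^d$), $C_f,C_b\ge 0$, and $\mathbf C$-bilinear maps $B_{k,l,m}:\mathbf C^r\times\mathbf C^r\to\mathbf C^r$ with $|B_{k,l,m}(x,y)|\le|x||y|$. Put $q_k=\sum_{l,m}q_{k,l,m}<\infty$ and assume $p_k+q_k+d_k=1$ for all $k$, and $p_k\to0$, $q_k\to0$ as $|k|\to\infty$. Let $T\ge 0$. $L^\infty([0,T],\ell^\infty(\mathbf C^r))$ denotes the families $f=(f_k)_{k\in\mathbf Z^d}$ of Lebesgue measurable functions $f_k:[0,T]\to\mathbf C^r$ with $\operatorname{ess\,sup}_{t\in[0,T]}\sup_k|f_k(t)|<\infty$. Let $\chi(0)=(\chi_k(0))_k$ satisfy $\sup_k|\chi_k(0)|<\infty$ and let $\gamma\in L^\infty([0,T],\ell^\infty(\mathbf C^r))$. Consider the system $$\dot\chi_k=\lambda_k\Big[-\chi_k+C_fp_k\chi_k+C_b\sum_{l,m\in\mathbf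 Z^d}q_{k,l,m}B_{k,l,m}(\chi_l,\chi_m)+d_k\gamma_k\Big],\qquad k\in\mathbf Z^d .$$ An $L^\infty([0,T],\ell^\infty(\mathbf C^r))$ mild solution for the data $\gamma,\chi(0)$ is a $\chi\in L^\infty([0,T],\ell^\infty(\mathbf C^r))$ such that for all $k\in\mathbf Z^d$ and all $t\in[0,T]$ $$\chi_k(t)=e^{-\lambda_kt}\chi_k(0)+\int_0^t\lambda_ke^{-\lambda_k(t-s)}\Big[C_fp_k\chi_k(s)+C_b\sum_{l,m}q_{k,l,m}B_{k,l,m}(\chi_l(s),\chi_m(s))+d_k\gamma_k(s)\Big]ds,$$ where the series converges for almost every $s$ and the integral converges. *The tree.* Labels are the finite words $\alpha=(\alpha_1,\dots,\alpha_n)$ over $\{0,1,2\}$; $\emptyset$ is the empty word. Take independent variables $E_\alpha$ (exponential of mean $1$), $U_\alpha$ (uniform on $[0,1]$) and $(Y^{(1)}_\alpha(k),Y^{(2)}_\alpha(k))$, for all labels $\alpha$ and all $k\in\mathbf Z^d$, the pair having the value $(l,m)$ with probability $q_{k,l,m}/q_k$ if $q_k>0$ (and any fixed law if $q_k=0$).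 For $k\in\mathbf Z^d$ put $\hat K_\emptyset=k$, $\tau^B_\emptyset=0$ and recursively $$\tau^D_\alpha=\tau^B_\alpha+\lambda_{\hat K_\alpha}^{-1}E_\alpha,\qquad \tau^B_{(\alpha,i)}=\tau^D_\alpha,\qquad \hat K_{(\alpha,0)}=\hat K_\alpha,\quad \hat K_{(\alpha,i)}=Y^{(i)}_\alpha(\hat K_\alpha)\ (i=1,2).$$ Let $I_{(\alpha,0)}=1$ if $U_\alpha\in[0,p_{\hat K_\alpha}]$ and $I_{(\alpha,1)}=I_{(\alpha,2)}=1$ if $U_\alpha\in[1-q_{\hat K_\alpha},1]$, and let these indicators be $0$ otherwise. Let $K_\alpha=\hat K_\alpha$ if $I=1$ at all the nonempty prefixes of $\alpha$ (including $\alpha$), and $K_\alpha=\Delta$, a cemetery state, otherwise. Let $\mathsf P_k$ be the law of the tree $(K_\alpha,\tau^B_\alpha,\tau^D_\alpha)_\alpha$, and $\mathsf E_k$ the expectation under $\mathsf P_k$. *The evaluation.* For a tree $\mathcal T=(k_\alpha,s_\alpha,t_\alpha)_\alpha$ let $\pi_i(\mathcal T)=(k_{(i,\alpha)},s_{(i,\alpha)}-t_\emptyset,t_{(i,\alpha)}-t_\emptyset)_\alpha$,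 $i=0,1,2$. The evaluation $R_t(\mathcal T)\in\mathbf C^r$ is given by the recursion $$R_t(\mathcal T)=\begin{cases}\chi_{k_\emptyset}(0)& t_\emptyset\ge t,\\ \gamma_{k_\emptyset}(t-t_\emptyset)& t_\emptyset<t,\ k_{(0)}=k_{(1)}=k_{(2)}=\Delta,\\ C_f\,R_{t-t_\emptyset}(\pi_0(\mathcal T))& t_\emptyset<t,\ k_{(0)}\ne\Delta,\ k_{(1)}=k_{(2)}=\Delta,\\ C_b\,B_{k_\emptyset,k_{(1)},k_{(2)}}\big(R_{t-t_\emptyset}(\pi_1(\mathcal T)),R_{t-t_\emptyset}(\pi_2(\mathcal T))\big)& t_\emptyset<t,\ k_{(0)}=\Delta,\ k_{(1)},k_{(2)}\neq\Delta,\end{cases}$$ started from the value $0$ and iterated until it is stationary ($R_t=0$ if $k_\emptyset=\Delta$ or if none of the four cases applies at the root). **Theorem.** Suppose that there is a finite constant $C$ with $\mathsf E_k|R_t|\le C$ for all $k\in\mathbf Z^d$ and all $t\in[0,T]$. Then each $R_t$, $t\in[0,T]$, is $\mathsf P_k$-integrable, the family $\chi_k(t)=\mathsf E_k[R_t]$ is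 an $L^\infty([0,T],\ell^\infty(\mathbf C^r))$ mild solution of the system for the data $\gamma,\chi(0)$, and it is the only one: every such mild solution equals $\mathsf E_k[R_t]$ for all $t\in[0,T]$ and $k\in\mathbf Z^d$. -/

import Mathlib

open MeasureTheory ProbabilityTheory Set Filter Topology
open scoped NNReal ENNReal

noncomputable section

namespace TreeRep

/-- Fourier modes, the elements of `ℤ^d`. -/
abbrev Mode (d : ℕ) : Type := Fin d → ℤ

/-- The state space `ℂ^r` with its Hermitian norm. -/
abbrev Vec (r : ℕ) : Type := EuclideanSpace ℂ (Fin r)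

/-- The coefficients of the quadratic system, with the standing assumptions on them:
`rate k` is `λ_k`, `p k`, `q k l m`, `dth k` are the flip, branching and death probabilities,
`Cf`, `Cb` the flipping and branching constants and `B k l m` the bilinear operators.
Together with non-negativity, `prob_sum` puts all the probabilities in `[0,1]`. -/
structure System (d r : ℕ) where
  rate : Mode d → ℝ
  p : Mode d → ℝ
  q : Mode d → Mode d → Mode d → ℝ
  dth : Mode d → ℝ
  Cf : ℝ
  Cb : ℝ
  B : Mode d → Mode d → Mode d → Vec r →ₗ[ℂ] Vec r →ₗ[ℂ] Vec r
  rate_pos : ∀ k, 0 < rate k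
  p_nonneg : ∀ k, 0 ≤ p k
  q_nonneg : ∀ k l m, 0 ≤ q k l m
  dth_nonneg : ∀ k, 0 ≤ dth k
  Cf_nonneg : 0 ≤ Cf
  Cb_nonneg : 0 ≤ Cb
  q_summable : ∀ k, Summable fun lm : Mode d × Mode d => q k lm.1 lm.2
  prob_sum : ∀ k, p k + (∑' lm : Mode d × Mode d, q k lm.1 lm.2) + dth k = 1
  B_bound : ∀ k l m x y, ‖B k l m x y‖ ≤ ‖x‖ * ‖y‖
  /-- `p_k → 0` as `|k| → ∞`; on `ℤ^d` this is the limit along the cofinite filter. -/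
  p_tendsto : Tendsto p cofinite (𝓝 0)
  /-- `q_k = ∑_{l,m} q_{k,l,m} → 0` as `|k| → ∞`. -/
  q_tendsto : Tendsto (fun k => ∑' lm : Mode d × Mode d, q k lm.1 lm.2) cofinite (𝓝 0)

variable {d r : ℕ}

/-- The total branching probability `q_k = ∑_{l,m} q_{k,l,m}`. -/
def System.qTot (S : System d r) (k : Mode d) : ℝ :=
  ∑' lm : Mode d × Mode d, S.q k lm.1 lm.2

/-! ### Mild solutions -/

/-- `f ∈ L^∞([0,T], ℓ^∞(ℂ^r))`: each component is Lebesgue measurable on `[0,T]`, and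
`‖f(t)‖_∞ = sup_k |f_k(t)|` is essentially bounded on `[0,T]`. -/
def IsLinfty (T : ℝ) (f : ℝ → Mode d → Vec r) : Prop :=
  (∀ k, AEStronglyMeasurable (fun t => f t k) (volume.restrict (Icc 0 T))) ∧
    ∃ M : ℝ, ∀ᵐ t ∂(volume.restrict (Icc 0 T)), ∀ k, ‖f t k‖ ≤ M

/-- The terms of the series `∑_{l,m} q_{k,l,m} B_{k,l,m}(x_l, x_m)`. -/
def System.quadTerm (S : System d r) (k : Mode d) (x : Mode d → Vec r)
    (lm : Mode d × Mode d) : Vec r :=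
  S.q k lm.1 lm.2 • S.B k lm.1 lm.2 (x lm.1) (x lm.2)

/-- The forcing bracket
`C_f p_k x_k + C_b ∑_{l,m} q_{k,l,m} B_{k,l,m}(x_l, x_m) + d_k g_k`. -/
def System.bracket (S : System d r) (g x : Mode d → Vec r) (k : Mode d) : Vec r :=
  (S.Cf * S.p k) • x k + S.Cb • (∑' lm, S.quadTerm k x lm) + S.dth k • g k

/-- `χ` is an `L^∞([0,T], ℓ^∞(ℂ^r))` mild solution on `[0,T]` with initial condition `χ₀` and
forcing `γ`. The series and the integral are required to converge (for `χ` and `γ` in `L^∞` they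
always do), and the integral equation holds at every time of `[0,T]`. -/
structure IsMildSolution (S : System d r) (T : ℝ) (χ₀ : Mode d → Vec r)
    (γ χ : ℝ → Mode d → Vec r) : Prop where
  linfty : IsLinfty T χ
  summable : ∀ k, ∀ᵐ s ∂(volume.restrict (Icc 0 T)), Summable (S.quadTerm k (χ s))
  integrable : ∀ k, ∀ t ∈ Icc 0 T, IntervalIntegrable
    (fun s => (S.rate k * Real.exp (-S.rate k * (t - s))) • S.bracket (γ s) (χ s) k) volume 0 t
  mild : ∀ k, ∀ t ∈ Icc 0 T, χ t k = Real.exp (-S.rate k * t) • χ₀ k +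
    ∫ s in (0 : ℝ)..t, (S.rate k * Real.exp (-S.rate k * (t - s))) • S.bracket (γ s) (χ s) k

/-! ### The branching tree -/

/-- Labels, i.e. finite words in `{0,1,2}`. The word `(α₁, …, αₙ)` is stored with its last letter
first, as `[αₙ, …, α₁]`: so `i :: α` is `(α, i)`, its tail is the parent, and `α ++ [i]` is
`(i, α)`. -/
abbrev Label : Type := List (Fin 3)

instance : MeasurableSpace (Option (Mode d)) := ⊤

/-- The space `((ℤ^d ∪ {Δ}) × ℝ × ℝ)^Label` of trees with the product σ-algebra; `none` is the
cemetery `Δ`. The entries at a label are position, birth time and death time. -/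
abbrev BTree (d : ℕ) : Type := Label → Option (Mode d) × ℝ × ℝ

/-- The shift `π_i`: the tree of descendants of the particle `(i)`, with time measured from the
death of the root. -/
def shift (i : Fin 3) (τ : BTree d) : BTree d := fun α =>
  ((τ (α ++ [i])).1, (τ (α ++ [i])).2.1 - (τ []).2.2, (τ (α ++ [i])).2.2 - (τ []).2.2)

/-- The variables attached to one label: an exponential clock `E`, a uniform variable `U` and, for
each mode `k`, the pair of positions `(Y¹(k), Y²(k))` of the offspring. -/
abbrev Noise (d : ℕ) : Type := ℝ × ℝ × (Mode d → Mode d × Mode d)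

/-- The law of the offspring positions of a particle at `k` that branches: mass
`q_{k,l,m} / q_k` at `(l,m)`. If `q_k = 0` no particle at `k` ever branches (up to a null event)
and the choice is immaterial. -/
def System.pairLaw (S : System d r) (k : Mode d) : Measure (Mode d × Mode d) :=
  if S.qTot k = 0 then Measure.dirac (0, 0)
  else Measure.sum fun lm : Mode d × Mode d =>
    ENNReal.ofReal (S.q k lm.1 lm.2 / S.qTot k) • Measure.dirac lm

instance (S : System d r) (k : Mode d) : IsProbabilityMeasure (S.pairLaw k) := by
  unfold System.pairLaw
  split_ifs with h
  · infer_instance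
  · constructor
    have hq : 0 ≤ S.qTot k := tsum_nonneg fun lm => S.q_nonneg _ _ _
    rw [Measure.sum_apply _ MeasurableSet.univ]
    simp only [Measure.smul_apply, measure_univ, smul_eq_mul, mul_one]
    rw [← ENNReal.ofReal_tsum_of_nonneg (fun lm => div_nonneg (S.q_nonneg _ _ _) hq)
      ((S.q_summable k).div_const _), tsum_div_const]
    change ENNReal.ofReal (S.qTot k / S.qTot k) = 1
    rw [div_self h, ENNReal.ofReal_one]

/-- The law of the variables at one label: `E` exponential of mean one, `U` uniform on `[0,1]` and
the offspring positions, all independent. -/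
def System.noiseLaw (S : System d r) : Measure (Noise d) :=
  (expMeasure 1).prod ((volume.restrict (Icc 0 1)).prod (Measure.infinitePi S.pairLaw))

instance (S : System d r) : IsProbabilityMeasure S.noiseLaw := by
  have := isProbabilityMeasure_expMeasure (r := 1) one_pos
  have : IsProbabilityMeasure ((volume : Measure ℝ).restrict (Icc 0 1)) := ⟨by simp⟩
  unfold System.noiseLaw
  infer_instance

/-- The sample space carrying independent copies of the variables for all the labels. -/
abbrev Sample (d : ℕ) : Type := Label → Noise d

def System.sampleLaw (S : System d r) : Measure (Sample d) :=
  Measure.infinitePi fun _ : Label => S.noiseLaw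

instance (S : System d r) : IsProbabilityMeasure S.sampleLaw := by
  unfold System.sampleLaw
  infer_instance

/-- Positions in the complete tree rooted at `k`: child `0` (flip) stays where its parent was,
children `1`, `2` (branching) sit at the two components of the parent's pair. -/
def pos (k : Mode d) (ω : Sample d) : Label → Mode d
  | [] => k
  | i :: α =>
    if i = 0 then pos k ω α
    else if i = 1 then ((ω α).2.2 (pos k ω α)).1
    else ((ω α).2.2 (pos k ω α)).2

/-- The life time of the particle `α` in the complete tree: exponential of rate `λ` at its
position. -/
def System.life (S : System d r) (k : Mode d) (ω : Sample d) (α : Label) : ℝ :=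
  (S.rate (pos k ω α))⁻¹ * (ω α).1

/-- Birth time: zero for the root, and otherwise the death time (birth plus life time) of the
parent. -/
def System.birth (S : System d r) (k : Mode d) (ω : Sample d) : Label → ℝ
  | [] => 0
  | _ :: α => S.birth k ω α + S.life k ω α

/-- Death time. -/
def System.death (S : System d r) (k : Mode d) (ω : Sample d) (α : Label) : ℝ :=
  S.birth k ω α + S.life k ω α

/-- The particle is present: all events along its line of ancestry occur. The parent, at `κ`, flips
if its uniform variable lies in `[0, p_κ]` and branches if it lies in `[1 - q_κ, 1]`. -/
def System.Alive (S : System d r) (k : Mode d) (ω : Sample d) : Label → Prop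
  | [] => True
  | i :: α => S.Alive k ω α ∧
    if i = 0 then (ω α).2.1 ∈ Icc 0 (S.p (pos k ω α))
    else (ω α).2.1 ∈ Icc (1 - S.qTot (pos k ω α)) 1

open Classical in
/-- The flip/branch/death tree rooted at `k`. -/
def System.tree (S : System d r) (k : Mode d) (ω : Sample d) : BTree d := fun α =>
  (if S.Alive k ω α then some (pos k ω α) else none, S.birth k ω α, S.death k ω α)

/-- The law `P_k` of the tree rooted at `k`. -/
def System.treeLaw (S : System d r) (k : Mode d) : Measure (BTree d) :=
  S.sampleLaw.map (S.tree k)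

/-! ### Evaluation along the tree -/

/-- The evaluation, cut off after `n` generations with the value `0`. The state of the root and
which of its three children are present decide between initial condition, death, flip and branch;
configurations that are none of these get the value `0`. -/
def System.evalN (S : System d r) (χ₀ : Mode d → Vec r) (γ : ℝ → Mode d → Vec r) :
    ℕ → ℝ → BTree d → Vec r
  | 0, _, _ => 0
  | n + 1, t, τ =>
    match (τ []).1 with
    | none => 0
    | some k =>
      if t ≤ (τ []).2.2 then χ₀ k
      else
        match (τ [0]).1, (τ [1]).1, (τ [2]).1 with
        | none, none, none => γ (t - (τ []).2.2) k
        | some _, none, none =>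
          S.Cf • S.evalN χ₀ γ n (t - (τ []).2.2) (shift 0 τ)
        | none, some l, some m =>
          S.Cb • S.B k l m (S.evalN χ₀ γ n (t - (τ []).2.2) (shift 1 τ))
            (S.evalN χ₀ γ n (t - (τ []).2.2) (shift 2 τ))
        | _, _, _ => 0

open Classical in
/-- The evaluation `R_t` for initial condition `χ₀` and forcing `γ`: the final value of the cut-off
evaluations as the number of generations grows. See `eval_eq` for the recursion it satisfies. -/
def System.eval (S : System d r) (χ₀ : Mode d → Vec r) (γ : ℝ → Mode d → Vec r)
    (t : ℝ) (τ : BTree d) : Vec r :=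
  if h : ∃ n, S.evalN χ₀ γ n t τ ≠ 0 then S.evalN χ₀ γ (Nat.find h) t τ else 0

/-! ### Sanity facts: the evaluation satisfies its recursion, and the tree law is a law -/

lemma System.evalN_stable (S : System d r) (χ₀ : Mode d → Vec r) (γ : ℝ → Mode d → Vec r)
    (n : ℕ) : ∀ (t : ℝ) (τ : BTree d), S.evalN χ₀ γ n t τ ≠ 0 →
      ∀ m, n ≤ m → S.evalN χ₀ γ m t τ = S.evalN χ₀ γ n t τ := by
  induction n with
  | zero => intro t τ h; exact absurd rfl h
  | succ n ih =>
    intro t τ h m hm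
    obtain ⟨m, rfl⟩ : ∃ m', m = m' + 1 := ⟨m - 1, by omega⟩
    have hnm : n ≤ m := by omega
    unfold System.evalN at h ⊢
    split at h
    · simp at h
    · split_ifs at h ⊢ with ht
      · rfl
      · split at h
        · rfl
        · have h' : S.evalN χ₀ γ n (t - (τ []).2.2) (shift 0 τ) ≠ 0 := by
            intro h0; simp [h0] at h
          simp only [ih _ _ h' m hnm]
        · have h1 : S.evalN χ₀ γ n (t - (τ []).2.2) (shift 1 τ) ≠ 0 := by
            intro h0; simp [h0] at h
          have h2 : S.evalN χ₀ γ n (t - (τ []).2.2) (shift 2 τ) ≠ 0 := by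
            intro h0; simp [h0] at h
          simp only [ih _ _ h1 m hnm, ih _ _ h2 m hnm]
        · simp at h

/-- On every tree the cut-off evaluations are eventually equal to `R_t`. -/
lemma System.evalN_eventually (S : System d r) (χ₀ : Mode d → Vec r) (γ : ℝ → Mode d → Vec r)
    (t : ℝ) (τ : BTree d) : ∀ᶠ n in atTop, S.evalN χ₀ γ n t τ = S.eval χ₀ γ t τ := by
  classical
  by_cases h : ∃ n, S.evalN χ₀ γ n t τ ≠ 0
  · filter_upwards [eventually_ge_atTop (Nat.find h)] with n hn
    rw [System.eval, dif_pos h]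
    exact S.evalN_stable χ₀ γ _ t τ (Nat.find_spec h) n hn
  · refine Eventually.of_forall fun n => ?_
    rw [System.eval, dif_neg h]
    push Not at h
    exact h n

/-- The recursive formula for `R_t`: initial condition, death, flip, branch. -/
theorem System.eval_eq (S : System d r) (χ₀ : Mode d → Vec r) (γ : ℝ → Mode d → Vec r)
    (t : ℝ) (τ : BTree d) (k : Mode d) (hk : (τ []).1 = some k) :
    (t ≤ (τ []).2.2 → S.eval χ₀ γ t τ = χ₀ k) ∧
    ((τ []).2.2 < t → (τ [0]).1 = none → (τ [1]).1 = none → (τ [2]).1 = none →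
      S.eval χ₀ γ t τ = γ (t - (τ []).2.2) k) ∧
    ((τ []).2.2 < t → (τ [0]).1 ≠ none → (τ [1]).1 = none → (τ [2]).1 = none →
      S.eval χ₀ γ t τ = S.Cf • S.eval χ₀ γ (t - (τ []).2.2) (shift 0 τ)) ∧
    (∀ l m, (τ []).2.2 < t → (τ [0]).1 = none → (τ [1]).1 = some l → (τ [2]).1 = some m →
      S.eval χ₀ γ t τ = S.Cb • S.B k l m (S.eval χ₀ γ (t - (τ []).2.2) (shift 1 τ))
        (S.eval χ₀ γ (t - (τ []).2.2) (shift 2 τ))) := by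
  obtain ⟨n, h1, h2, h3, h4⟩ := ((((tendsto_add_atTop_nat 1).eventually
    (S.evalN_eventually χ₀ γ t τ)).and
    ((S.evalN_eventually χ₀ γ (t - (τ []).2.2) (shift 0 τ)).and
    ((S.evalN_eventually χ₀ γ (t - (τ []).2.2) (shift 1 τ)).and
    (S.evalN_eventually χ₀ γ (t - (τ []).2.2) (shift 2 τ))))).exists)
  rw [← h1, ← h2, ← h3, ← h4, System.evalN, hk]
  refine ⟨fun h => by simp [h], fun h a b c => by simp [not_le.2 h, a, b, c],
    fun h a b c => ?_, fun l m h a b c => by simp [not_le.2 h, a, b, c]⟩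
  obtain ⟨k', a⟩ := Option.ne_none_iff_exists'.1 a
  simp [not_le.2 h, a, b, c]

lemma measurable_pos (k : Mode d) (α : Label) : Measurable fun ω : Sample d => pos k ω α := by
  induction α with
  | nil => exact measurable_const
  | cons i α ih =>
    have hY : Measurable fun ω : Sample d => (ω α).2.2 (pos k ω α) := by
      have h : Measurable fun z : (Mode d → Mode d × Mode d) × Mode d => z.1 z.2 :=
        measurable_from_prod_countable_left fun m => measurable_pi_apply m
      exact h.comp ((measurable_snd.comp (measurable_snd.comp (measurable_pi_apply α))).prodMk ih)
    simp only [pos]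
    split_ifs
    · exact ih
    · exact measurable_fst.comp hY
    · exact measurable_snd.comp hY

lemma System.measurable_life (S : System d r) (k : Mode d) (α : Label) :
    Measurable fun ω : Sample d => S.life k ω α :=
  ((measurable_of_countable fun m => (S.rate m)⁻¹).comp (measurable_pos k α)).mul
    (measurable_fst.comp (measurable_pi_apply α))

lemma System.measurable_birth (S : System d r) (k : Mode d) (α : Label) :
    Measurable fun ω : Sample d => S.birth k ω α := by
  induction α with
  | nil => exact measurable_const
  | cons i α ih => exact ih.add (S.measurable_life k α)

lemma System.measurableSet_alive (S : System d r) (k : Mode d) (α : Label) :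
    MeasurableSet {ω : Sample d | S.Alive k ω α} := by
  induction α with
  | nil => exact MeasurableSet.univ
  | cons i α ih =>
    have hU : Measurable fun ω : Sample d => (ω α).2.1 :=
      measurable_fst.comp (measurable_snd.comp (measurable_pi_apply α))
    have h : {ω : Sample d | S.Alive k ω (i :: α)} = {ω | S.Alive k ω α} ∩
        {ω | if i = 0 then (ω α).2.1 ∈ Icc 0 (S.p (pos k ω α))
          else (ω α).2.1 ∈ Icc (1 - S.qTot (pos k ω α)) 1} := rfl
    rw [h]
    refine ih.inter ?_
    split_ifs
    · exact (measurableSet_le measurable_const hU).inter (measurableSet_le hU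
        ((measurable_of_countable S.p).comp (measurable_pos k α)))
    · exact (measurableSet_le ((measurable_of_countable fun m => 1 - S.qTot m).comp
        (measurable_pos k α)) hU).inter (measurableSet_le hU measurable_const)

lemma System.measurable_tree (S : System d r) (k : Mode d) : Measurable (S.tree k) := by
  refine measurable_pi_lambda _ fun α => ?_
  refine Measurable.prodMk ?_ ((S.measurable_birth k α).prodMk
    ((S.measurable_birth k α).add (S.measurable_life k α)))
  exact Measurable.ite (S.measurableSet_alive k α)
    ((measurable_of_countable fun m : Mode d => some m).comp (measurable_pos k α))
    measurable_const

instance (S : System d r) (k : Mode d) : IsProbabilityMeasure (S.treeLaw k) :=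
  Measure.isProbabilityMeasure_map (S.measurable_tree k).aemeasurable

end TreeRep

end

open TreeRep

/-! Existence is the branching property. The clock, uniform variable and offspring pair of the root
are independent of one another and of the three families of variables below it
(`System.measurePreserving_rootData`), and a child that is present roots a fresh tree at its own
position (`System.shift_tree`). Averaging the recursion for $R_t$ over everything except the clock
therefore turns the flip, branch and death cases into the three terms of the bracket, evaluated at
the means. In the branch case the two subtrees are independent given their positions, so the mean of
the bilinear term is the bilinear term of the means (`System.integral_branch`,
`System.integral_offspringValue`). The remaining average over the exponential clock becomes the mild
equation after the substitution $s = t - e/\lambda_k$ (`integral_exp_clock`). The uniform bound on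
$\mathsf E_k|R_t|$ justifies Fubini and also bounds the solution.

The forcing is measurable only up to null sets, so $R_t$ is first studied for a measurable version.
Since death times almost surely avoid a given null set (`System.ae_death_notMem`), the two
evaluations agree almost surely (`System.eval_ae_eq`).

Uniqueness is analytic and does not involve the tree. The rates may be unbounded, so a Gronwall
argument with one rate for all modes is not available. For two solutions bounded by $M$, the bracket
at $k$ has Lipschitz constant $c_k = C_f p_k + 2M C_b q_k$, which tends to $0$. In the norm weighted
by $e^{-\beta t}$ the equation at $k$ contracts by $c_k\lambda_k/(\lambda_k+\beta)$. This is below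
$1/2$ whatever the rate once $c_k < 1/2$, and a large $\beta$ takes care of the finitely many other
modes (`exists_weight`). Iteration sends the difference to $0$. -/

noncomputable section

namespace TreeRep

variable {d r : ℕ}

set_option synthInstance.maxSize 1000

/-! ### The root and the three subtrees of a family indexed by labels -/

section RootDecomposition

variable {X : Type*}

/-- The subfamily indexed by the descendants of the label `(i)`. -/
def subfamily (i : Fin 3) (ω : Label → X) : Label → X := fun α => ω (α ++ [i])

/-- The family with prescribed root value and prescribed subfamilies. -/
def assemble (z : X × (Label → X) × (Label → X) × (Label → X)) : Label → X := fun α =>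
  if h : α = [] then z.1 else (![z.2.1, z.2.2.1, z.2.2.2] (α.getLast h)) α.dropLast

@[simp] lemma assemble_nil (z : X × (Label → X) × (Label → X) × (Label → X)) :
    assemble z [] = z.1 := by simp [assemble]

@[simp] lemma assemble_append (z : X × (Label → X) × (Label → X) × (Label → X)) (i : Fin 3)
    (α : Label) : assemble z (α ++ [i]) = (![z.2.1, z.2.2.1, z.2.2.2] i) α := by
  simp [assemble]

variable [MeasurableSpace X]

lemma measurable_subfamily (i : Fin 3) :
    Measurable (subfamily i : (Label → X) → Label → X) :=
  measurable_pi_lambda _ fun _ => measurable_pi_apply _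

lemma measurable_assemble :
    Measurable (assemble : X × (Label → X) × (Label → X) × (Label → X) → Label → X) := by
  refine measurable_pi_lambda _ fun α => ?_
  rcases List.eq_nil_or_concat α with rfl | ⟨β, i, rfl⟩
  · simpa using measurable_fst
  · simp only [List.concat_eq_append, assemble_append]
    fin_cases i
    · exact (measurable_pi_apply β).comp (measurable_fst.comp measurable_snd)
    · exact (measurable_pi_apply β).comp (measurable_fst.comp (measurable_snd.comp measurable_snd))
    · exact (measurable_pi_apply β).comp (measurable_snd.comp (measurable_snd.comp measurable_snd))

/-- A product measure is determined by its values on finite boxes, and the preimage of a box under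
`assemble` is a product of four boxes: one for the root and one for each subfamily. -/
lemma map_assemble (ν : Measure X) [IsProbabilityMeasure ν] :
    (ν.prod ((Measure.infinitePi fun _ : Label => ν).prod
      ((Measure.infinitePi fun _ : Label => ν).prod (Measure.infinitePi fun _ : Label => ν)))).map
        assemble = Measure.infinitePi fun _ : Label => ν := by
  classical
  refine Measure.eq_infinitePi _ fun s t ht => ?_
  -- One index set `A` serves all three subfamilies. Words $\beta$ followed by a first letter that
  -- lie outside `s` get the side `univ`, of mass one, so enlarging the box changes neither the set
  -- nor the product.
  set A : Finset Label := s.image List.dropLast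
  set t' : Label → Set X := fun α => if α ∈ s then t α else univ
  have ht' : ∀ α, MeasurableSet (t' α) := fun α => by
    simp only [t']; split_ifs; exacts [ht α, MeasurableSet.univ]
  set e : Fin 3 × Label → Label := fun p => p.2 ++ [p.1]
  have he : Function.Injective e := fun p p' h => by
    have := List.append_inj' h rfl
    exact Prod.ext (by simpa using this.2) this.1
  set A' : Finset Label := insert [] ((Finset.univ ×ˢ A).image e)
  have hsA : s ⊆ A' := fun α hα => by
    rcases List.eq_nil_or_concat α with rfl | ⟨β, i, rfl⟩
    · simp [A']
    · simp only [A', Finset.mem_insert, Finset.mem_image]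
      refine Or.inr ⟨(i, β), ?_, by simp [e]⟩
      simp only [Finset.mem_product, Finset.mem_univ, true_and, A, Finset.mem_image]
      exact ⟨_, hα, by simp⟩
  have hprod : ∏ α ∈ s, ν (t α) = ν (t' []) * ∏ i : Fin 3, ∏ β ∈ A, ν (t' (β ++ [i])) := by
    have h1 : ∏ α ∈ s, ν (t α) = ∏ α ∈ A', ν (t' α) := by
      rw [← Finset.prod_subset hsA (f := fun α => ν (t' α))]
      · exact Finset.prod_congr rfl fun α hα => by simp [t', hα]
      · intro α _ hα; simp [t', hα]
    rw [h1, Finset.prod_insert (by simp [e]), Finset.prod_image he.injOn,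
      Finset.prod_product]
  have hbox : assemble ⁻¹' (Set.pi s t) = t' [] ×ˢ
      (Set.pi A (fun β => t' (β ++ [0])) ×ˢ (Set.pi A (fun β => t' (β ++ [1])) ×ˢ
        Set.pi A (fun β => t' (β ++ [2])))) := by
    have h1 : (Set.pi s t : Set (Label → X)) = Set.pi A' t' := by
      ext ω
      simp only [Set.mem_pi, Finset.mem_coe]
      refine ⟨fun h α _ => ?_, fun h α hα => ?_⟩
      · by_cases hα : α ∈ s
        · simpa [t', hα] using h α hα
        · simp [t', hα]
      · simpa [t', hα] using h α (hsA hα)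
    rw [h1]
    ext ⟨x, w0, w1, w2⟩
    simp only [mem_preimage, Set.mem_pi, Finset.mem_coe, mem_prod, A', Finset.mem_insert,
      Finset.mem_image, Finset.mem_product, Finset.mem_univ, true_and, Prod.exists, e]
    constructor
    · intro h
      refine ⟨by simpa using h [] (Or.inl rfl), fun β hβ => ?_, fun β hβ => ?_, fun β hβ => ?_⟩
      · simpa using h (β ++ [0]) (Or.inr ⟨0, β, hβ, rfl⟩)
      · simpa using h (β ++ [1]) (Or.inr ⟨1, β, hβ, rfl⟩)
      · simpa using h (β ++ [2]) (Or.inr ⟨2, β, hβ, rfl⟩)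
    · rintro ⟨h, h0, h1, h2⟩ α (rfl | ⟨i, β, hβ, rfl⟩)
      · simpa using h
      · rw [assemble_append]
        fin_cases i
        exacts [h0 β hβ, h1 β hβ, h2 β hβ]
  rw [Measure.map_apply measurable_assemble (MeasurableSet.pi s.countable_toSet fun α _ => ht α),
    hbox, Measure.prod_prod, Measure.prod_prod, Measure.prod_prod, hprod, Fin.prod_univ_three,
    Measure.infinitePi_pi _ (fun _ _ => ht' _), Measure.infinitePi_pi _ (fun _ _ => ht' _),
    Measure.infinitePi_pi _ (fun _ _ => ht' _), mul_assoc]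

/-- The root variable and the three subfamilies of an i.i.d. family are independent, and the
subfamilies are distributed like the whole family. -/
lemma measurePreserving_root_subfamily (ν : Measure X) [IsProbabilityMeasure ν] :
    MeasurePreserving
      (fun ω : Label → X => (ω [], subfamily 0 ω, subfamily 1 ω, subfamily 2 ω))
      (Measure.infinitePi fun _ : Label => ν)
      (ν.prod ((Measure.infinitePi fun _ : Label => ν).prod
        ((Measure.infinitePi fun _ : Label => ν).prod
          (Measure.infinitePi fun _ : Label => ν)))) := by
  have hm : Measurable
      (fun ω : Label → X => (ω [], subfamily 0 ω, subfamily 1 ω, subfamily 2 ω)) :=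
    (measurable_pi_apply _).prodMk ((measurable_subfamily 0).prodMk
      ((measurable_subfamily 1).prodMk (measurable_subfamily 2)))
  refine ⟨hm, ?_⟩
  -- With the product measure written as an image under `assemble`, it remains that splitting after
  -- assembling is the identity.
  rw [← map_assemble ν, Measure.map_map hm measurable_assemble]
  convert Measure.map_id
  · ext z α <;> simp [subfamily]
  all_goals exact map_assemble ν

end RootDecomposition

/-! ### Subtrees -/

/-- Induction on `α` adds the most recent letter, at the head of the list, and leaves the first
generation `i` at its end untouched. The analogous identities for life, birth, death and presence
follow the same pattern; together they give `System.shift_tree`. -/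
lemma pos_append (k : Mode d) (ω : Sample d) (i : Fin 3) (α : Label) :
    pos k ω (α ++ [i]) = pos (pos k ω [i]) (subfamily i ω) α := by
  induction α with
  | nil => rfl
  | cons j α ih =>
    rw [List.cons_append, pos.eq_2, pos.eq_2, ih]
    rfl

lemma System.life_append (S : System d r) (k : Mode d) (ω : Sample d) (i : Fin 3) (α : Label) :
    S.life k ω (α ++ [i]) = S.life (pos k ω [i]) (subfamily i ω) α := by
  rw [System.life, System.life, pos_append]
  rfl

lemma System.birth_append (S : System d r) (k : Mode d) (ω : Sample d) (i : Fin 3) (α : Label) :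
    S.birth k ω (α ++ [i]) =
      S.birth (pos k ω [i]) (subfamily i ω) α + S.death k ω [] := by
  induction α with
  | nil => simp [System.birth, System.death]
  | cons j α ih =>
    rw [List.cons_append, System.birth, System.birth, ih, S.life_append]
    ring

lemma System.death_append (S : System d r) (k : Mode d) (ω : Sample d) (i : Fin 3) (α : Label) :
    S.death k ω (α ++ [i]) =
      S.death (pos k ω [i]) (subfamily i ω) α + S.death k ω [] := by
  rw [System.death, S.birth_append, S.life_append, System.death, System.death]
  ring

lemma System.death_nil (S : System d r) (k : Mode d) (ω : Sample d) :
    S.death k ω [] = (S.rate k)⁻¹ * (ω []).1 := by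
  simp [System.death, System.birth, System.life, pos]

lemma System.alive_append (S : System d r) (k : Mode d) (ω : Sample d) (i : Fin 3) (α : Label) :
    S.Alive k ω (α ++ [i]) ↔
      S.Alive k ω [i] ∧ S.Alive (pos k ω [i]) (subfamily i ω) α := by
  induction α with
  | nil => simp [System.Alive]
  | cons j α ih =>
    rw [List.cons_append, System.Alive, ih, pos_append, and_assoc]
    rfl

/-- The descendants of a child that is present form the tree rooted at its position. -/
lemma System.shift_tree (S : System d r) (k : Mode d) (ω : Sample d) (i : Fin 3)
    (h : S.Alive k ω [i]) :
    shift i (S.tree k ω) = S.tree (pos k ω [i]) (subfamily i ω) := by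
  funext α
  have ha : S.Alive k ω (α ++ [i]) ↔ S.Alive (pos k ω [i]) (subfamily i ω) α := by
    rw [S.alive_append, and_iff_right h]
  by_cases hb : S.Alive (pos k ω [i]) (subfamily i ω) α
  · simp [shift, System.tree, ha.2 hb, hb, pos_append, S.birth_append, S.death_append]
  · simp [shift, System.tree, mt ha.1 hb, hb, S.birth_append, S.death_append]

/-! ### Dependence of the evaluation on the forcing -/

/-- The forcing is read only at the times $t$ minus a death time. Passing to a subtree subtracts the
death time of the root from both, so these differences are unchanged. -/
lemma System.evalN_congr (S : System d r) (χ₀ : Mode d → Vec r) {γ γ' : ℝ → Mode d → Vec r}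
    (n : ℕ) : ∀ (t : ℝ) (τ : BTree d),
      (∀ α, (τ α).2.2 < t → γ (t - (τ α).2.2) = γ' (t - (τ α).2.2)) →
      S.evalN χ₀ γ n t τ = S.evalN χ₀ γ' n t τ := by
  induction n with
  | zero => intro t τ _; rfl
  | succ n ih =>
    intro t τ h
    have hs : ∀ i, S.evalN χ₀ γ n (t - (τ []).2.2) (shift i τ) =
        S.evalN χ₀ γ' n (t - (τ []).2.2) (shift i τ) := fun i => by
      refine ih _ _ fun α hα => ?_
      simp only [shift, sub_sub_sub_cancel_right, sub_lt_sub_iff_right] at hα ⊢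
      exact h _ hα
    unfold System.evalN
    split
    · rfl
    · split_ifs with ht
      · rfl
      · split
        · rw [h [] (not_le.1 ht)]
        · rw [hs]
        · rw [hs, hs]
        · rfl

lemma System.eval_congr (S : System d r) (χ₀ : Mode d → Vec r) {γ γ' : ℝ → Mode d → Vec r}
    {t : ℝ} {τ : BTree d}
    (h : ∀ α, (τ α).2.2 < t → γ (t - (τ α).2.2) = γ' (t - (τ α).2.2)) :
    S.eval χ₀ γ t τ = S.eval χ₀ γ' t τ := by
  obtain ⟨n, h1, h2⟩ := ((S.evalN_eventually χ₀ γ t τ).and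
    (S.evalN_eventually χ₀ γ' t τ)).exists
  rw [← h1, ← h2, S.evalN_congr χ₀ n t τ h]

/-! ### Measurability of the evaluation -/

instance : MeasurableSingletonClass (Option (Mode d)) := ⟨fun _ => trivial⟩

/-- A bilinear operator of the system as a continuous bilinear map. -/
def System.bilin (S : System d r) (k l m : Mode d) : Vec r →L[ℂ] Vec r →L[ℂ] Vec r :=
  (S.B k l m).mkContinuous₂ 1 fun x y => by simpa using S.B_bound k l m x y

@[simp] lemma System.bilin_apply (S : System d r) (k l m : Mode d) (x y : Vec r) :
    S.bilin k l m x y = S.B k l m x y := rfl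

lemma measurable_shift (i : Fin 3) : Measurable (shift i : BTree d → BTree d) := by
  unfold shift
  fun_prop

/-- The states of the root and its children range over a countable set. Once they are frozen as a
separate argument, each case of the recursion is a measurable expression, and countability glues the
cases. -/
lemma System.measurable_evalN (S : System d r) (χ₀ : Mode d → Vec r) {γ : ℝ → Mode d → Vec r}
    (hγ : ∀ k, Measurable fun t => γ t k) (n : ℕ) :
    Measurable fun z : ℝ × BTree d => S.evalN χ₀ γ n z.1 z.2 := by
  induction n with
  | zero => exact measurable_const
  | succ n ih =>
    have hdeath : Measurable fun z : ℝ × BTree d => (z.2 []).2.2 := by fun_prop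
    have hsub : Measurable fun z : ℝ × BTree d => z.1 - (z.2 []).2.2 := by fun_prop
    have hs : ∀ i, Measurable fun z : ℝ × BTree d =>
        S.evalN χ₀ γ n (z.1 - (z.2 []).2.2) (shift i z.2) := fun i =>
      ih.comp (hsub.prodMk ((measurable_shift i).comp measurable_snd))
    let G : (Option (Mode d) × Option (Mode d) × Option (Mode d) × Option (Mode d)) →
        ℝ × BTree d → Vec r := fun o z =>
      match o.1 with
      | none => 0
      | some k =>
        if z.1 ≤ (z.2 []).2.2 then χ₀ k
        else
          match o.2.1, o.2.2.1, o.2.2.2 with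
          | none, none, none => γ (z.1 - (z.2 []).2.2) k
          | some _, none, none =>
            S.Cf • S.evalN χ₀ γ n (z.1 - (z.2 []).2.2) (shift 0 z.2)
          | none, some l, some m =>
            S.Cb • S.B k l m (S.evalN χ₀ γ n (z.1 - (z.2 []).2.2) (shift 1 z.2))
              (S.evalN χ₀ γ n (z.1 - (z.2 []).2.2) (shift 2 z.2))
          | _, _, _ => 0
    have hG : Measurable fun p : (Option (Mode d) × Option (Mode d) × Option (Mode d) ×
        Option (Mode d)) × (ℝ × BTree d) => G p.1 p.2 := by
      refine measurable_from_prod_countable_right fun o => ?_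
      simp only [G]
      split
      · exact measurable_const
      · refine Measurable.ite (measurableSet_le measurable_fst hdeath) measurable_const ?_
        split
        · exact (hγ _).comp hsub
        · exact (hs 0).const_smul S.Cf
        · rename_i k _ _ _ _ l m _ _ _
          have hc : Measurable fun p : Vec r × Vec r => S.bilin k l m p.1 p.2 :=
            (S.bilin k l m).continuous₂.measurable
          exact (hc.comp ((hs 1).prodMk (hs 2))).const_smul S.Cb
        · exact measurable_const
    have h := hG.comp (((show Measurable fun z : ℝ × BTree d =>
      ((z.2 []).1, (z.2 [0]).1, (z.2 [1]).1, (z.2 [2]).1) by fun_prop)).prodMk measurable_id)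
    exact h

/-- For a measurable forcing the evaluation is jointly measurable in time and tree. -/
lemma System.measurable_eval (S : System d r) (χ₀ : Mode d → Vec r) {γ : ℝ → Mode d → Vec r}
    (hγ : ∀ k, Measurable fun t => γ t k) :
    Measurable fun z : ℝ × BTree d => S.eval χ₀ γ z.1 z.2 := by
  refine measurable_of_tendsto_metrizable (fun n => S.measurable_evalN χ₀ hγ n) ?_
  rw [tendsto_pi_nhds]
  intro z
  exact tendsto_const_nhds.congr' ((S.evalN_eventually χ₀ γ z.1 z.2).mono fun n h => h.symm)

/-! ### Law of the root and of the subtrees -/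

instance : IsProbabilityMeasure (expMeasure 1) := isProbabilityMeasure_expMeasure one_pos

instance : IsProbabilityMeasure ((volume : Measure ℝ).restrict (Icc 0 1)) := ⟨by simp⟩

/-- Regrouping of factors. It serves to keep, from the offspring positions attached to all modes,
only the pair for the mode of the root. -/
lemma measurePreserving_map_third {A B C C' W : Type*} [MeasurableSpace A] [MeasurableSpace B]
    [MeasurableSpace C] [MeasurableSpace C'] [MeasurableSpace W] {c : Measure C} {c' : Measure C'}
    [SFinite c] [SFinite c'] {f : C → C'} (hf : MeasurePreserving f c c') (a : Measure A)
    (b : Measure B) (w : Measure W) [SFinite a] [SFinite b] [SFinite w] :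
    MeasurePreserving (fun z : (A × B × C) × W => (z.1.1, z.1.2.1, f z.1.2.2, z.2))
      ((a.prod (b.prod c)).prod w) (a.prod (b.prod (c'.prod w))) := by
  have h1 : MeasurePreserving (fun z : (A × B × C) × W => (z.1.1, z.1.2, z.2))
      ((a.prod (b.prod c)).prod w) (a.prod ((b.prod c).prod w)) := measurePreserving_prodAssoc _ _ _
  have h2 : MeasurePreserving (fun z : (B × C) × W => (z.1.1, z.1.2, z.2))
      ((b.prod c).prod w) (b.prod (c.prod w)) := measurePreserving_prodAssoc _ _ _
  have h3 := (MeasurePreserving.id b).prod (hf.prod (MeasurePreserving.id w))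
  exact ((MeasurePreserving.id a).prod (h3.comp h2)).comp h1

/-- The clock, the uniform variable and the offspring positions of a root at `k`, together with the
samples of its three subtrees. -/
def rootData (k : Mode d) (ω : Sample d) :
    ℝ × ℝ × (Mode d × Mode d) × Sample d × Sample d × Sample d :=
  ((ω []).1, (ω []).2.1, (ω []).2.2 k, subfamily 0 ω, subfamily 1 ω, subfamily 2 ω)

lemma System.measurePreserving_rootData (S : System d r) (k : Mode d) :
    MeasurePreserving (rootData k) S.sampleLaw
      ((expMeasure 1).prod ((volume.restrict (Icc 0 1)).prod
        ((S.pairLaw k).prod (S.sampleLaw.prod (S.sampleLaw.prod S.sampleLaw))))) := by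
  have h1 := measurePreserving_root_subfamily S.noiseLaw
  exact (measurePreserving_map_third (measurePreserving_eval_infinitePi S.pairLaw k)
    (expMeasure 1) (volume.restrict (Icc 0 1))
    (S.sampleLaw.prod (S.sampleLaw.prod S.sampleLaw))).comp h1

lemma System.measurePreserving_clock_subfamily (S : System d r) (i : Fin 3) :
    MeasurePreserving (fun ω : Sample d => ((ω []).1, subfamily i ω)) S.sampleLaw
      ((expMeasure 1).prod S.sampleLaw) := by
  -- The mode is arbitrary, since the offspring pair is discarded.
  have h := S.measurePreserving_rootData 0
  have hi : MeasurePreserving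
      (fun w : Sample d × Sample d × Sample d => ![w.1, w.2.1, w.2.2] i)
      (S.sampleLaw.prod (S.sampleLaw.prod S.sampleLaw)) S.sampleLaw := by
    fin_cases i
    · exact measurePreserving_fst
    · exact measurePreserving_fst.comp measurePreserving_snd
    · exact measurePreserving_snd.comp measurePreserving_snd
  have h' := ((MeasurePreserving.id (expMeasure 1)).prod
    (hi.comp (measurePreserving_snd.comp measurePreserving_snd))).comp h
  convert h' using 1
  funext ω
  fin_cases i <;> rfl

lemma System.measurePreserving_noise (S : System d r) (α : Label) :
    MeasurePreserving (fun ω : Sample d => ω α) S.sampleLaw S.noiseLaw :=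
  measurePreserving_eval_infinitePi _ α

lemma expMeasure_absolutelyContinuous (a : ℝ) : expMeasure a ≪ volume :=
  withDensity_absolutelyContinuous _ _

lemma expMeasure_one_eq :
    expMeasure 1 = (volume.restrict (Ici (0 : ℝ))).withDensity
      fun x => ENNReal.ofReal (Real.exp (-x)) := by
  rw [← withDensity_indicator measurableSet_Ici]
  change volume.withDensity (exponentialPDF 1) = _
  congr 1
  funext x
  rw [exponentialPDF_eq, indicator_apply]
  by_cases h : 0 ≤ x <;> simp [h]

lemma ae_expMeasure_nonneg : ∀ᵐ x ∂(expMeasure 1), 0 ≤ x := by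
  rw [expMeasure_one_eq]
  exact (withDensity_absolutelyContinuous _ _).ae_le (ae_restrict_mem measurableSet_Ici)

/-- The clocks are real variables whose sign is controlled only almost surely. Non-negative death
times keep the arguments of the forcing at most $T$ in `System.eval_ae_eq`. -/
lemma System.ae_clock_nonneg (S : System d r) :
    ∀ᵐ ω ∂S.sampleLaw, ∀ α : Label, 0 ≤ (ω α).1 := by
  rw [ae_all_iff]
  intro α
  have h : MeasurePreserving (fun ω : Sample d => (ω α).1) S.sampleLaw (expMeasure 1) :=
    measurePreserving_fst.comp (S.measurePreserving_noise α)
  exact h.quasiMeasurePreserving.ae ae_expMeasure_nonneg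

lemma System.birth_nonneg (S : System d r) (k : Mode d) {ω : Sample d}
    (h : ∀ α : Label, 0 ≤ (ω α).1) (α : Label) : 0 ≤ S.birth k ω α := by
  induction α with
  | nil => exact le_rfl
  | cons i α ih => exact add_nonneg ih (mul_nonneg (inv_nonneg.2 (S.rate_pos _).le) (h α))

lemma System.death_nonneg (S : System d r) (k : Mode d) {ω : Sample d}
    (h : ∀ α : Label, 0 ≤ (ω α).1) (α : Label) : 0 ≤ S.death k ω α :=
  add_nonneg (S.birth_nonneg k h α) (mul_nonneg (inv_nonneg.2 (S.rate_pos _).le) (h α))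

/-- Death times have no atoms and avoid Lebesgue null sets. -/
lemma System.ae_death_notMem (S : System d r) (α : Label) :
    ∀ (k : Mode d) {Z : Set ℝ}, MeasurableSet Z → volume Z = 0 →
      ∀ᵐ ω ∂S.sampleLaw, S.death k ω α ∉ Z := by
  induction α using List.reverseRecOn with
  | nil =>
    intro k Z hZ hZ0
    have h : MeasurePreserving (fun ω : Sample d => (ω []).1) S.sampleLaw (expMeasure 1) :=
      measurePreserving_fst.comp (S.measurePreserving_noise [])
    simp only [S.death_nil]
    refine h.quasiMeasurePreserving.ae (p := fun x => (S.rate k)⁻¹ * x ∉ Z) ?_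
    refine (expMeasure_absolutelyContinuous 1).ae_le ?_
    refine measure_eq_zero_iff_ae_notMem.1 ?_
    change volume ((fun x => (S.rate k)⁻¹ * x) ⁻¹' Z) = 0
    rw [Real.volume_preimage_mul_left (inv_ne_zero (S.rate_pos k).ne'), hZ0, mul_zero]
  | append_singleton α i ih =>
    intro k Z hZ hZ0
    -- The position of the child is random, but it takes countably many values, so the claim is
    -- proved for all of them at once.
    have h : ∀ k' : Mode d, ∀ᵐ ω ∂S.sampleLaw,
        S.death k' (subfamily i ω) α + (S.rate k)⁻¹ * (ω []).1 ∉ Z := fun k' => by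
      refine (S.measurePreserving_clock_subfamily i).quasiMeasurePreserving.ae
        (p := fun z => S.death k' z.2 α + (S.rate k)⁻¹ * z.1 ∉ Z) ?_
      have hm : Measurable fun z : ℝ × Sample d => S.death k' z.2 α + (S.rate k)⁻¹ * z.1 :=
        (((S.measurable_birth k' α).add (S.measurable_life k' α)).comp measurable_snd).add
          (measurable_fst.const_mul _)
      refine (Measure.ae_prod_mem_iff_ae_ae_mem (hm hZ.compl)).2 (Eventually.of_forall fun x => ?_)
      -- For a fixed root clock `x`, the root's life time only translates the null set.
      refine ih k' (Z := (fun s => s + (S.rate k)⁻¹ * x) ⁻¹' Z)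
        ((measurable_id.add_const _) hZ) ?_
      rw [measure_preimage_add_right, hZ0]
    filter_upwards [ae_all_iff.2 h] with ω hω
    rw [S.death_append, S.death_nil]
    exact hω _

/-- Modifying the forcing on a null set of times does not change the evaluation almost surely. -/
lemma System.eval_ae_eq (S : System d r) (χ₀ : Mode d → Vec r) {γ γ' : ℝ → Mode d → Vec r}
    {T : ℝ} (h : ∀ᵐ s ∂(volume.restrict (Icc 0 T)), γ s = γ' s) (k : Mode d) {t : ℝ}
    (ht : t ≤ T) : S.eval χ₀ γ t =ᵐ[S.treeLaw k] S.eval χ₀ γ' t := by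
  rw [ae_restrict_iff' measurableSet_Icc] at h
  obtain ⟨N, hN, hNm, hN0⟩ := exists_measurable_superset_of_null h
  have hgood : ∀ᵐ τ ∂(S.treeLaw k), ∀ α, (τ α).2.2 < t → γ (t - (τ α).2.2) = γ' (t - (τ α).2.2) := by
    have hm : MeasurableSet {τ : BTree d | ∀ α, 0 ≤ (τ α).2.2 ∧ t - (τ α).2.2 ∉ N} := by
      rw [ofPred_forall]
      refine MeasurableSet.iInter fun α => ?_
      have hd : Measurable fun τ : BTree d => (τ α).2.2 := by fun_prop
      exact (measurableSet_le measurable_const hd).inter ((measurable_const.sub hd) hNm.compl)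
    have h1 : ∀ᵐ τ ∂(S.treeLaw k), ∀ α, 0 ≤ (τ α).2.2 ∧ t - (τ α).2.2 ∉ N := by
      rw [System.treeLaw, ae_map_iff (S.measurable_tree k).aemeasurable hm]
      have h2 : ∀ α, ∀ᵐ ω ∂S.sampleLaw, S.death k ω α ∉ (fun s => t - s) ⁻¹' N := fun α => by
        refine S.ae_death_notMem α k ((measurable_const.sub measurable_id) hNm) ?_
        rw [(Measure.measurePreserving_sub_left volume t).measure_preimage hNm.nullMeasurableSet, hN0]
      filter_upwards [S.ae_clock_nonneg, ae_all_iff.2 h2] with ω h3 h4 α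
      exact ⟨S.death_nonneg k h3 α, h4 α⟩
    filter_upwards [h1] with τ hτ α hα
    by_contra hne
    refine (hτ α).2 (hN ?_)
    simp only [mem_compl_iff, mem_ofPred_eq, Classical.not_imp]
    exact ⟨⟨by linarith, by linarith [(hτ α).1]⟩, hne⟩
  filter_upwards [hgood] with τ hτ
  exact S.eval_congr χ₀ hτ

/-- A forcing in `L^∞` has a measurable version. -/
lemma IsLinfty.exists_measurable_version {T : ℝ} {γ : ℝ → Mode d → Vec r} (h : IsLinfty T γ) :
    ∃ γ' : ℝ → Mode d → Vec r, (∀ k, Measurable fun t => γ' t k) ∧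
      ∀ᵐ s ∂(volume.restrict (Icc 0 T)), γ s = γ' s := by
  refine ⟨fun s k => (h.1 k).mk _ s, fun k => (h.1 k).stronglyMeasurable_mk.measurable, ?_⟩
  filter_upwards [ae_all_iff.2 fun k => (h.1 k).ae_eq_mk] with s hs
  exact funext hs

/-! ### The first event -/

/-- The value contributed by the offspring of a root at `k` when its uniform variable, the
positions of its branching offspring and the samples of its subtrees are the given ones. Here `f`
evaluates the subtrees and `g` is the value in case of death. -/
def System.offspringValue (S : System d r) (k : Mode d) (g : Vec r) (f : Mode d → Sample d → Vec r)
    (z : ℝ × (Mode d × Mode d) × Sample d × Sample d × Sample d) : Vec r :=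
  (Iio (S.p k)).indicator (1 : ℝ → ℝ) z.1 • S.Cf • f k z.2.2.1 +
    (Ioi (1 - S.qTot k)).indicator (1 : ℝ → ℝ) z.1 •
      S.Cb • S.bilin k z.2.1.1 z.2.1.2 (f z.2.1.1 z.2.2.2.1) (f z.2.1.2 z.2.2.2.2) +
    (Ioo (S.p k) (1 - S.qTot k)).indicator (1 : ℝ → ℝ) z.1 • g

/-- The evaluation at time `t` of a tree rooted at `k` as a function of its first event. -/
def System.firstEventValue (S : System d r) (χ₀ : Mode d → Vec r) (γ : ℝ → Mode d → Vec r)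
    (k : Mode d) (t : ℝ) (z : ℝ × ℝ × (Mode d × Mode d) × Sample d × Sample d × Sample d) : Vec r :=
  if t ≤ (S.rate k)⁻¹ * z.1 then χ₀ k
  else S.offspringValue k (γ (t - (S.rate k)⁻¹ * z.1) k)
    (fun l w => S.eval χ₀ γ (t - (S.rate k)⁻¹ * z.1) (S.tree l w)) z.2

lemma System.qTot_nonneg (S : System d r) (k : Mode d) : 0 ≤ S.qTot k :=
  tsum_nonneg fun _ => S.q_nonneg _ _ _

lemma System.p_add_qTot_add_dth (S : System d r) (k : Mode d) : S.p k + S.qTot k + S.dth k = 1 :=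
  S.prob_sum k

/-- The evaluation in terms of the first event, for almost all samples. -/
lemma System.eval_tree_eq (S : System d r) (χ₀ : Mode d → Vec r) (γ : ℝ → Mode d → Vec r)
    (k : Mode d) {ω : Sample d} (hu : (ω []).2.1 ∈ Icc (0 : ℝ) 1) (hp : (ω []).2.1 ≠ S.p k)
    (hq : (ω []).2.1 ≠ 1 - S.qTot k) (t : ℝ) :
    S.eval χ₀ γ t (S.tree k ω) =
      S.firstEventValue χ₀ γ k t (rootData k ω) := by
  have hsum := S.p_add_qTot_add_dth k
  have hd := S.dth_nonneg k
  have hroot : (S.tree k ω []).1 = some k := by simp [System.tree, System.Alive, pos]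
  have hdeath : (S.tree k ω []).2.2 = (S.rate k)⁻¹ * (ω []).1 := S.death_nil k ω
  have hchild : ∀ i, (S.Alive k ω [i] → (S.tree k ω [i]).1 = some (pos k ω [i])) ∧
      (¬ S.Alive k ω [i] → (S.tree k ω [i]).1 = none) := fun i =>
    ⟨fun h => by simp [System.tree, h], fun h => by simp [System.tree, h]⟩
  have h0 : S.Alive k ω [0] ↔ (ω []).2.1 < S.p k := by
    simp only [System.Alive, pos, if_true, true_and, mem_Icc]
    exact ⟨fun h => lt_of_le_of_ne h.2 hp, fun h => ⟨hu.1, h.le⟩⟩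
  have h12 : ∀ i : Fin 3, i ≠ 0 → (S.Alive k ω [i] ↔ 1 - S.qTot k < (ω []).2.1) := fun i hi => by
    simp only [System.Alive, pos, if_neg hi, true_and, mem_Icc]
    exact ⟨fun h => lt_of_le_of_ne h.1 hq.symm, fun h => ⟨h.le, hu.2⟩⟩
  have h1 := h12 1 (by decide)
  have h2 := h12 2 (by decide)
  obtain ⟨e1, e2, e3, e4⟩ := S.eval_eq χ₀ γ t (S.tree k ω) k hroot
  rw [hdeath] at e1 e2 e3 e4
  unfold System.firstEventValue
  by_cases ht : t ≤ (S.rate k)⁻¹ * (rootData k ω).1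
  · rw [if_pos ht]
    exact e1 ht
  · rw [if_neg ht]
    rw [not_le] at ht
    replace ht : (S.rate k)⁻¹ * (ω []).1 < t := ht
    simp only [rootData, System.offspringValue, indicator_apply, mem_Iio, mem_Ioi, mem_Ioo]
    rcases lt_trichotomy (ω []).2.1 (S.p k) with hlt | heq | hgt
    · have n1 : ¬ (1 - S.qTot k < (ω []).2.1) := by linarith
      rw [e3 ht (by rw [(hchild 0).1 (h0.2 hlt)]; simp) ((hchild 1).2 (mt h1.1 n1))
        ((hchild 2).2 (mt h2.1 n1)), S.shift_tree k ω 0 (h0.2 hlt)]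
      simp [hlt, n1, hlt.not_gt, pos]
    · exact absurd heq hp
    · rcases lt_trichotomy (ω []).2.1 (1 - S.qTot k) with hlt' | heq' | hgt'
      · rw [e2 ht ((hchild 0).2 (mt h0.1 hgt.not_gt)) ((hchild 1).2 (mt h1.1 hlt'.not_gt))
          ((hchild 2).2 (mt h2.1 hlt'.not_gt))]
        simp [hgt, hlt', hgt.not_gt, hlt'.not_gt]
      · exact absurd heq' hq
      · rw [e4 _ _ ht ((hchild 0).2 (mt h0.1 hgt.not_gt)) ((hchild 1).1 (h1.2 hgt'))
          ((hchild 2).1 (h2.2 hgt')), S.shift_tree k ω 1 (h1.2 hgt'),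
          S.shift_tree k ω 2 (h2.2 hgt')]
        simp [hgt', hgt.not_gt, hgt'.not_gt, pos]

/-- The closed intervals for flip and branch differ from the open ones in `System.offspringValue`
only at the endpoints $p_k$ and $1-q_k$, which a uniform variable almost surely avoids. This also
disposes of the overlap at $p_k = 1-q_k$ when $d_k = 0$. -/
lemma System.ae_eval_tree_eq (S : System d r) (χ₀ : Mode d → Vec r) (γ : ℝ → Mode d → Vec r)
    (k : Mode d) (t : ℝ) :
    ∀ᵐ ω ∂S.sampleLaw, S.eval χ₀ γ t (S.tree k ω) =
      S.firstEventValue χ₀ γ k t (rootData k ω) := by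
  have h : MeasurePreserving (fun ω : Sample d => (rootData k ω).2.1) S.sampleLaw
      (volume.restrict (Icc 0 1)) :=
    measurePreserving_fst.comp (measurePreserving_snd.comp (S.measurePreserving_rootData k))
  have hne : ∀ a : ℝ, ∀ᵐ u ∂((volume : Measure ℝ).restrict (Icc 0 1)), u ≠ a := fun a =>
    ae_restrict_of_ae (Measure.ae_ne volume a)
  filter_upwards [h.quasiMeasurePreserving.ae (ae_restrict_mem measurableSet_Icc),
    h.quasiMeasurePreserving.ae (hne (S.p k)),
    h.quasiMeasurePreserving.ae (hne (1 - S.qTot k))] with ω h1 h2 h3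
  exact S.eval_tree_eq χ₀ γ k h1 h2 h3 t

lemma System.measurable_bilin (S : System d r) (k : Mode d) :
    Measurable fun p : (Mode d × Mode d) × Vec r × Vec r =>
      S.bilin k p.1.1 p.1.2 p.2.1 p.2.2 :=
  measurable_from_prod_countable_right fun lm => (S.bilin k lm.1 lm.2).continuous₂.measurable

/-- The branching law weighted by the branching probability. -/
lemma System.qTot_smul_integral_pairLaw (S : System d r) (k : Mode d)
    (f : Mode d × Mode d → Vec r) :
    S.qTot k • ∫ y, f y ∂(S.pairLaw k) = ∑' lm : Mode d × Mode d, S.q k lm.1 lm.2 • f lm := by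
  by_cases h : S.qTot k = 0
  · have hs : HasSum (fun lm : Mode d × Mode d => S.q k lm.1 lm.2) (S.qTot k) :=
      (S.q_summable k).hasSum
    rw [h] at hs
    have h0 : ∀ lm : Mode d × Mode d, S.q k lm.1 lm.2 = 0 := fun lm =>
      congrFun ((hasSum_zero_iff_of_nonneg fun lm => S.q_nonneg k lm.1 lm.2).1 hs) lm
    simp [h, h0]
  · rw [System.pairLaw, if_neg h, integral_sum_dirac fun _ => ENNReal.ofReal_ne_top,
      ← tsum_const_smul'']
    refine tsum_congr fun lm => ?_
    rw [ENNReal.toReal_ofReal (div_nonneg (S.q_nonneg _ _ _) (S.qTot_nonneg k)), smul_smul,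
      mul_div_cancel₀ _ h]

lemma integrable_indicator_one_unitInterval {s : Set ℝ} (hs : MeasurableSet s) :
    Integrable (s.indicator (1 : ℝ → ℝ)) (volume.restrict (Icc 0 1)) :=
  (integrable_const (1 : ℝ)).indicator hs

lemma System.integral_flip_indicator (S : System d r) (k : Mode d) :
    ∫ u in Icc (0 : ℝ) 1, (Iio (S.p k)).indicator (1 : ℝ → ℝ) u = S.p k := by
  rw [integral_indicator_one measurableSet_Iio, measureReal_restrict_apply measurableSet_Iio]
  have : Iio (S.p k) ∩ Icc 0 1 = Ico 0 (S.p k) := by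
    ext u; simp only [mem_inter_iff, mem_Iio, mem_Icc, mem_Ico]
    exact ⟨fun h => ⟨h.2.1, h.1⟩, fun h => ⟨h.2, h.1, by
      linarith [h.2, S.p_add_qTot_add_dth k, S.dth_nonneg k, S.qTot_nonneg k]⟩⟩
  rw [this, Real.volume_real_Ico_of_le (S.p_nonneg k), sub_zero]

lemma System.integral_branch_indicator (S : System d r) (k : Mode d) :
    ∫ u in Icc (0 : ℝ) 1, (Ioi (1 - S.qTot k)).indicator (1 : ℝ → ℝ) u = S.qTot k := by
  rw [integral_indicator_one measurableSet_Ioi, measureReal_restrict_apply measurableSet_Ioi]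
  have : Ioi (1 - S.qTot k) ∩ Icc 0 1 = Ioc (1 - S.qTot k) 1 := by
    ext u; simp only [mem_inter_iff, mem_Ioi, mem_Icc, mem_Ioc]
    exact ⟨fun h => ⟨h.1, h.2.2⟩, fun h => ⟨h.1, by
      linarith [h.1, S.p_add_qTot_add_dth k, S.dth_nonneg k, S.p_nonneg k], h.2⟩⟩
  rw [this, Real.volume_real_Ioc_of_le (by linarith [S.qTot_nonneg k])]
  ring

lemma System.integral_death_indicator (S : System d r) (k : Mode d) :
    ∫ u in Icc (0 : ℝ) 1, (Ioo (S.p k) (1 - S.qTot k)).indicator (1 : ℝ → ℝ) u = S.dth k := by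
  have hsum := S.p_add_qTot_add_dth k
  rw [integral_indicator_one measurableSet_Ioo, measureReal_restrict_apply measurableSet_Ioo]
  have : Ioo (S.p k) (1 - S.qTot k) ∩ Icc 0 1 = Ioo (S.p k) (1 - S.qTot k) := by
    refine inter_eq_left.2 fun u hu => ⟨by linarith [hu.1, S.p_nonneg k], by
      linarith [hu.2, S.qTot_nonneg k]⟩
  rw [this, Real.volume_real_Ioo_of_le (by linarith [S.dth_nonneg k])]
  linarith

/-- The law of the offspring positions of a root at `k` and of the samples of its subtrees. -/
def System.offspringLaw (S : System d r) (k : Mode d) :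
    Measure ((Mode d × Mode d) × Sample d × Sample d × Sample d) :=
  (S.pairLaw k).prod (S.sampleLaw.prod (S.sampleLaw.prod S.sampleLaw))

instance (S : System d r) (k : Mode d) : IsProbabilityMeasure (S.offspringLaw k) := by
  unfold System.offspringLaw
  infer_instance

lemma System.integrable_flip (S : System d r) (k : Mode d) {f : Sample d → Vec r}
    (hf : Integrable f S.sampleLaw) :
    Integrable (fun z : (Mode d × Mode d) × Sample d × Sample d × Sample d => f z.2.1)
      (S.offspringLaw k) :=
  (hf.comp_fst _).comp_snd (S.pairLaw k)

lemma System.integral_flip (S : System d r) (k : Mode d) (f : Sample d → Vec r) :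
    ∫ z : (Mode d × Mode d) × Sample d × Sample d × Sample d, f z.2.1 ∂(S.offspringLaw k) =
      ∫ w, f w ∂S.sampleLaw := by
  rw [System.offspringLaw, integral_fun_snd (fun w : Sample d × Sample d × Sample d => f w.1),
    integral_fun_fst]
  simp

/-- For fixed positions the two subtree values are independent, so the norm of the bilinear term has
mean at most $C\cdot C$. Since `C` does not depend on the mode, averaging over the positions stays
finite. -/
lemma System.integrable_branch_pair (S : System d r) (k : Mode d)
    {f : Mode d → Sample d → Vec r} (hf : ∀ l, Integrable (f l) S.sampleLaw) {C : ℝ}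
    (hfm : ∀ l, Measurable (f l)) (hC : ∀ l, ∫ w, ‖f l w‖ ∂S.sampleLaw ≤ C) :
    Integrable (fun z : (Mode d × Mode d) × Sample d × Sample d =>
      S.bilin k z.1.1 z.1.2 (f z.1.1 z.2.1) (f z.1.2 z.2.2))
      ((S.pairLaw k).prod (S.sampleLaw.prod S.sampleLaw)) := by
  have hC0 : 0 ≤ C := (integral_nonneg fun _ => norm_nonneg _).trans (hC 0)
  have hpair : ∀ y : Mode d × Mode d, Integrable
      (fun w : Sample d × Sample d => S.bilin k y.1 y.2 (f y.1 w.1) (f y.2 w.2))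
      (S.sampleLaw.prod S.sampleLaw) := fun y =>
    (hf y.1).op_fst_snd (by fun_prop) ⟨_, (S.bilin k y.1 y.2).le_opNorm₂⟩ (hf y.2)
  have hfm' : Measurable fun p : Mode d × Sample d => f p.1 p.2 :=
    measurable_from_prod_countable_right hfm
  have hbm : Measurable (fun z : (Mode d × Mode d) × Sample d × Sample d =>
      S.bilin k z.1.1 z.1.2 (f z.1.1 z.2.1) (f z.1.2 z.2.2)) :=
    (S.measurable_bilin k).comp (measurable_fst.prodMk
      ((hfm'.comp (measurable_fst.fst.prodMk measurable_snd.fst)).prodMk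
        (hfm'.comp (measurable_fst.snd.prodMk measurable_snd.snd))))
  rw [integrable_prod_iff hbm.aestronglyMeasurable]
  refine ⟨Eventually.of_forall hpair, ?_⟩
  refine Integrable.mono' (integrable_const (C * C))
    (measurable_of_countable _).aestronglyMeasurable (Eventually.of_forall fun y => ?_)
  rw [Real.norm_of_nonneg (integral_nonneg fun _ => norm_nonneg _)]
  calc _ ≤ ∫ w : Sample d × Sample d, ‖f y.1 w.1‖ * ‖f y.2 w.2‖
        ∂(S.sampleLaw.prod S.sampleLaw) :=
        integral_mono (hpair y).norm ((hf y.1).norm.mul_prod (hf y.2).norm)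
          fun w => S.B_bound _ _ _ _ _
    _ = (∫ w, ‖f y.1 w‖ ∂S.sampleLaw) * ∫ w, ‖f y.2 w‖ ∂S.sampleLaw :=
        integral_prod_mul (fun w => ‖f y.1 w‖) (fun w => ‖f y.2 w‖)
    _ ≤ C * C := mul_le_mul (hC _) (hC _) (integral_nonneg fun _ => norm_nonneg _) hC0

lemma System.measurePreserving_forget_flip (S : System d r) (k : Mode d) : MeasurePreserving
    (fun z : (Mode d × Mode d) × Sample d × Sample d × Sample d => (z.1, z.2.2))
    (S.offspringLaw k) ((S.pairLaw k).prod (S.sampleLaw.prod S.sampleLaw)) :=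
  (MeasurePreserving.id _).prod measurePreserving_snd

lemma System.integrable_branch (S : System d r) (k : Mode d)
    {f : Mode d → Sample d → Vec r} (hf : ∀ l, Integrable (f l) S.sampleLaw) {C : ℝ}
    (hfm : ∀ l, Measurable (f l)) (hC : ∀ l, ∫ w, ‖f l w‖ ∂S.sampleLaw ≤ C) :
    Integrable (fun z : (Mode d × Mode d) × Sample d × Sample d × Sample d =>
      S.bilin k z.1.1 z.1.2 (f z.1.1 z.2.2.1) (f z.1.2 z.2.2.2)) (S.offspringLaw k) :=
  (S.measurePreserving_forget_flip k).integrable_comp_of_integrable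
    (S.integrable_branch_pair k hf hfm hC)

/-- Given the positions, independence of the two subtrees lets the expectation pass into both
arguments of the bilinear map. -/
lemma System.integral_branch (S : System d r) (k : Mode d)
    {f : Mode d → Sample d → Vec r} (hf : ∀ l, Integrable (f l) S.sampleLaw) {C : ℝ}
    (hfm : ∀ l, Measurable (f l)) (hC : ∀ l, ∫ w, ‖f l w‖ ∂S.sampleLaw ≤ C) :
    ∫ z : (Mode d × Mode d) × Sample d × Sample d × Sample d,
      S.bilin k z.1.1 z.1.2 (f z.1.1 z.2.2.1) (f z.1.2 z.2.2.2) ∂(S.offspringLaw k) =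
      ∫ y, S.B k y.1 y.2 (∫ w, f y.1 w ∂S.sampleLaw) (∫ w, f y.2 w ∂S.sampleLaw)
        ∂(S.pairLaw k) := by
  have h := S.integrable_branch_pair k hf hfm hC
  have hmp := S.measurePreserving_forget_flip k
  have hmap := integral_map (μ := S.offspringLaw k) hmp.measurable.aemeasurable
    (f := fun z : (Mode d × Mode d) × Sample d × Sample d =>
      S.bilin k z.1.1 z.1.2 (f z.1.1 z.2.1) (f z.1.2 z.2.2))
    (by rw [hmp.map_eq]; exact h.aestronglyMeasurable)
  rw [hmp.map_eq] at hmap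
  rw [← hmap, integral_prod _ h]
  refine integral_congr_ae (Eventually.of_forall fun y => ?_)
  exact integral_prod_bilin (S.bilin k y.1 y.2) (hf y.1) (hf y.2)

/-- Independence of the uniform variable, which selects the event, from the values that the
offspring contribute. -/
lemma integral_three_products {U W E : Type*} [MeasurableSpace U] [MeasurableSpace W]
    [NormedAddCommGroup E] [NormedSpace ℝ E] {μ : Measure U} {ν : Measure W} [SFinite μ]
    [SFinite ν] {φ₁ φ₂ φ₃ : U → ℝ} {h₁ h₂ h₃ : W → E} (i₁ : Integrable φ₁ μ) (i₂ : Integrable φ₂ μ)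
    (i₃ : Integrable φ₃ μ) (j₁ : Integrable h₁ ν) (j₂ : Integrable h₂ ν) (j₃ : Integrable h₃ ν) :
    ∫ z, (φ₁ z.1 • h₁ z.2 + φ₂ z.1 • h₂ z.2 + φ₃ z.1 • h₃ z.2) ∂(μ.prod ν) =
      (∫ u, φ₁ u ∂μ) • (∫ w, h₁ w ∂ν) + (∫ u, φ₂ u ∂μ) • (∫ w, h₂ w ∂ν) +
        (∫ u, φ₃ u ∂μ) • ∫ w, h₃ w ∂ν := by
  have h₁₂ : Integrable (fun z : U × W => φ₁ z.1 • h₁ z.2 + φ₂ z.1 • h₂ z.2) (μ.prod ν) :=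
    (i₁.smul_prod j₁).add (i₂.smul_prod j₂)
  rw [integral_add h₁₂ (i₃.smul_prod j₃),
    integral_add (i₁.smul_prod j₁) (i₂.smul_prod j₂), integral_prod_smul, integral_prod_smul,
    integral_prod_smul]

/-- The mean value contributed by the offspring of a root at `k` is the forcing bracket. -/
lemma System.integral_offspringValue (S : System d r) (k : Mode d) (g : Mode d → Vec r)
    {f : Mode d → Sample d → Vec r} (hf : ∀ l, Integrable (f l) S.sampleLaw) {C : ℝ}
    (hfm : ∀ l, Measurable (f l)) (hC : ∀ l, ∫ w, ‖f l w‖ ∂S.sampleLaw ≤ C) :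
    ∫ z, S.offspringValue k (g k) f z ∂((volume.restrict (Icc 0 1)).prod (S.offspringLaw k)) =
      S.bracket g (fun l => ∫ w, f l w ∂S.sampleLaw) k := by
  refine (integral_three_products
    (integrable_indicator_one_unitInterval measurableSet_Iio)
    (integrable_indicator_one_unitInterval measurableSet_Ioi)
    (integrable_indicator_one_unitInterval measurableSet_Ioo)
    ((S.integrable_flip k (hf k)).smul S.Cf)
    ((S.integrable_branch k hf hfm hC).smul S.Cb) (integrable_const (g k))).trans ?_
  simp only [Pi.smul_apply]
  rw [S.integral_flip_indicator, S.integral_branch_indicator, S.integral_death_indicator,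
    integral_smul, integral_smul, S.integral_flip k (f k), S.integral_branch k hf hfm hC,
    smul_comm (S.qTot k) S.Cb, S.qTot_smul_integral_pairLaw, smul_smul, mul_comm (S.p k)]
  simp [System.quadTerm, System.bracket]

/-! ### Integrating over the first clock -/

/-- Averaging over an exponential clock, rescaled to rate `a` and stopped at `t`. -/
lemma integral_exp_clock {E : Type*} [NormedAddCommGroup E] [NormedSpace ℝ E] [CompleteSpace E]
    {a t : ℝ} (ha : 0 < a) (ht : 0 ≤ t) (x : E) (b : ℝ → E)
    (h : Integrable (fun e => if t ≤ a⁻¹ * e then x else b (t - a⁻¹ * e)) (expMeasure 1)) :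
    IntervalIntegrable (fun s => (a * Real.exp (-a * (t - s))) • b s) volume 0 t ∧
      ∫ e, (if t ≤ a⁻¹ * e then x else b (t - a⁻¹ * e)) ∂(expMeasure 1) =
        Real.exp (-a * t) • x + ∫ s in (0 : ℝ)..t, (a * Real.exp (-a * (t - s))) • b s := by
  have hat : 0 ≤ a * t := mul_nonneg ha.le ht
  have hmeas : Measurable fun x : ℝ => ENNReal.ofReal (Real.exp (-x)) := by fun_prop
  have hlt : ∀ᵐ x ∂((volume : Measure ℝ).restrict (Ici 0)),
      ENNReal.ofReal (Real.exp (-x)) < ⊤ := Eventually.of_forall fun _ => ENNReal.ofReal_lt_top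
  have htoReal : ∀ x : ℝ, (ENNReal.ofReal (Real.exp (-x))).toReal = Real.exp (-x) := fun x =>
    ENNReal.toReal_ofReal (Real.exp_pos _).le
  have hiff : ∀ e : ℝ, t ≤ a⁻¹ * e ↔ a * t ≤ e := fun e => by
    rw [inv_mul_eq_div, le_div_iff₀ ha, mul_comm]
  simp only [hiff] at h ⊢
  rw [expMeasure_one_eq] at h ⊢
  rw [integrable_withDensity_iff_integrable_smul' hmeas hlt] at h
  rw [integral_withDensity_eq_integral_toReal_smul hmeas hlt]
  simp only [htoReal] at h ⊢
  have hI : IntegrableOn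
      (fun e => Real.exp (-e) • if a * t ≤ e then x else b (t - a⁻¹ * e)) (Ioi 0) :=
    h.mono_measure (Measure.restrict_mono Ioi_subset_Ici_self le_rfl)
  have hIoc : Ioc 0 (a * t) ⊆ Ioi 0 := Ioc_subset_Ioi_self
  have hIoi : Ioi (a * t) ⊆ Ioi 0 := Ioi_subset_Ioi hat
  -- Almost everywhere only, because at the endpoint $e = at$ the initial value is selected.
  have hb_ae : ∀ᵐ e ∂((volume : Measure ℝ).restrict (Ioc 0 (a * t))),
      (Real.exp (-e) • if a * t ≤ e then x else b (t - a⁻¹ * e)) =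
        Real.exp (-e) • b (t - a⁻¹ * e) := by
    filter_upwards [ae_restrict_mem measurableSet_Ioc,
      ae_restrict_of_ae (Measure.ae_ne volume (a * t))] with e he hne
    rw [if_neg (not_le.2 (lt_of_le_of_ne he.2 hne))]
  -- The substitution $e = at - as$ turns the exponential density into the kernel of the mild
  -- equation; the factor `a` is its Jacobian.
  have hsub : ∀ s : ℝ, a • (Real.exp (-(a * t - a * s)) • b (t - a⁻¹ * (a * t - a * s))) =
      (a * Real.exp (-a * (t - s))) • b s := fun s => by
    have h1 : t - a⁻¹ * (a * t - a * s) = s := by field_simp; ring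
    have h2 : -(a * t - a * s) = -a * (t - s) := by ring
    rw [h1, h2, smul_smul]
  have hgI : IntervalIntegrable (fun e => Real.exp (-e) • b (t - a⁻¹ * e)) volume 0 (a * t) := by
    rw [intervalIntegrable_iff_integrableOn_Ioc_of_le hat]
    exact (hI.mono_set hIoc).congr hb_ae
  constructor
  -- The reflection $e \mapsto at - e$ and the scaling by `a` carry $[0,at]$ to $[0,t]$ with
  -- reversed orientation.
  · have h1 := (hgI.comp_sub_left (a * t)).comp_mul_left (c := a)
    rw [sub_zero, sub_self, zero_div, mul_div_cancel_left₀ _ ha.ne'] at h1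
    have h2 := h1.symm.smul a
    exact h2.congr fun s _ => hsub s
  · rw [integral_Ici_eq_integral_Ioi, ← Ioc_union_Ioi_eq_Ioi hat,
      setIntegral_union (Ioc_disjoint_Ioi le_rfl) measurableSet_Ioi (hI.mono_set hIoc)
        (hI.mono_set hIoi), add_comm]
    congr 1
    · rw [setIntegral_congr_fun (g := fun e => Real.exp (-e) • x) measurableSet_Ioi
        fun e he => by rw [if_pos (le_of_lt he)], integral_smul_const, integral_exp_neg_Ioi, neg_mul]
    · rw [integral_congr_ae hb_ae, ← intervalIntegral.integral_of_le hat]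
      have h1 := intervalIntegral.integral_comp_sub_mul (a := 0) (b := t)
        (fun e => Real.exp (-e) • b (t - a⁻¹ * e)) ha.ne' (a * t)
      rw [sub_self, mul_zero, sub_zero] at h1
      rw [← intervalIntegral.integral_congr fun s _ => hsub s, intervalIntegral.integral_smul, h1,
        smul_inv_smul₀ ha.ne']

/-! ### The mean value is a mild solution -/

/-- The mean `E_k[R_t]` of the evaluation. -/
def System.mean (S : System d r) (χ₀ : Mode d → Vec r) (γ : ℝ → Mode d → Vec r) (t : ℝ)
    (k : Mode d) : Vec r :=
  ∫ τ, S.eval χ₀ γ t τ ∂(S.treeLaw k)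

section MeasurableForcing

variable {χ₀ : Mode d → Vec r} {γ : ℝ → Mode d → Vec r}

lemma System.measurable_eval_right (S : System d r) (hγ : ∀ k, Measurable fun t => γ t k) (t : ℝ) :
    Measurable (S.eval χ₀ γ t) :=
  (S.measurable_eval χ₀ hγ).comp measurable_prodMk_left

lemma System.mean_eq (S : System d r) (hγ : ∀ k, Measurable fun t => γ t k) (t : ℝ) (k : Mode d) :
    S.mean χ₀ γ t k = ∫ ω, S.eval χ₀ γ t (S.tree k ω) ∂S.sampleLaw :=
  integral_map (S.measurable_tree k).aemeasurable
    (S.measurable_eval_right hγ t).aestronglyMeasurable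

lemma System.measurable_eval_tree (S : System d r) (hγ : ∀ k, Measurable fun t => γ t k) :
    Measurable fun p : Mode d × ℝ × Sample d => S.eval χ₀ γ p.2.1 (S.tree p.1 p.2.2) :=
  measurable_from_prod_countable_right fun k =>
    (S.measurable_eval χ₀ hγ).comp (measurable_fst.prodMk ((S.measurable_tree k).comp measurable_snd))

lemma System.measurable_mean (S : System d r) (hγ : ∀ k, Measurable fun t => γ t k) (k : Mode d) :
    StronglyMeasurable fun t => S.mean χ₀ γ t k :=
  (S.measurable_eval χ₀ hγ).stronglyMeasurable.integral_prod_right'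

lemma System.measurable_firstEventValue (S : System d r) (hγ : ∀ k, Measurable fun t => γ t k)
    (k : Mode d) (t : ℝ) :
    Measurable (S.firstEventValue χ₀ γ k t) := by
  have hs : Measurable fun z : ℝ × ℝ × (Mode d × Mode d) × Sample d × Sample d × Sample d =>
      t - (S.rate k)⁻¹ * z.1 := measurable_const.sub (measurable_fst.const_mul _)
  have hu : Measurable fun z : ℝ × ℝ × (Mode d × Mode d) × Sample d × Sample d × Sample d =>
      z.2.1 := measurable_snd.fst
  have hy : Measurable fun z : ℝ × ℝ × (Mode d × Mode d) × Sample d × Sample d × Sample d =>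
      z.2.2.1 := measurable_snd.snd.fst
  have hw0 : Measurable fun z : ℝ × ℝ × (Mode d × Mode d) × Sample d × Sample d × Sample d =>
      z.2.2.2.1 := measurable_snd.snd.snd.fst
  have hw1 : Measurable fun z : ℝ × ℝ × (Mode d × Mode d) × Sample d × Sample d × Sample d =>
      z.2.2.2.2.1 := measurable_snd.snd.snd.snd.fst
  have hw2 : Measurable fun z : ℝ × ℝ × (Mode d × Mode d) × Sample d × Sample d × Sample d =>
      z.2.2.2.2.2 := measurable_snd.snd.snd.snd.snd
  have hind : ∀ s : Set ℝ, MeasurableSet s →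
      Measurable fun z : ℝ × ℝ × (Mode d × Mode d) × Sample d × Sample d × Sample d =>
        s.indicator (1 : ℝ → ℝ) z.2.1 := fun s hs => (measurable_one.indicator hs).comp hu
  have hF := S.measurable_eval_tree (χ₀ := χ₀) hγ
  have h0 := hF.comp (measurable_const (a := k) |>.prodMk (hs.prodMk hw0))
  have h1 := hF.comp (hy.fst.prodMk (hs.prodMk hw1))
  have h2 := hF.comp (hy.snd.prodMk (hs.prodMk hw2))
  have hB := (S.measurable_bilin k).comp (hy.prodMk (h1.prodMk h2))
  refine Measurable.ite (measurableSet_le measurable_const (measurable_fst.const_mul _))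
    measurable_const ?_
  exact (((hind _ measurableSet_Iio).smul (h0.const_smul S.Cf)).add
    ((hind _ measurableSet_Ioi).smul (hB.const_smul S.Cb))).add
    ((hind _ measurableSet_Ioo).smul ((hγ k).comp hs))

/-- Fubini after transport along `D`. Integrability is known only for `F`, and passes from it to `H`
and then to `G`. -/
lemma integral_of_measurePreserving_prod {Ω U W E : Type*} [MeasurableSpace Ω] [MeasurableSpace U]
    [MeasurableSpace W] [NormedAddCommGroup E] [NormedSpace ℝ E] {P : Measure Ω} {μ : Measure U}
    {ν : Measure W} [SFinite μ] [SFinite ν] {D : Ω → U × W} (hD : MeasurePreserving D P (μ.prod ν))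
    {F : Ω → E} {H : U × W → E} {G : U → E} (hF : Integrable F P) (hFH : ∀ᵐ ω ∂P, F ω = H (D ω))
    (hH : AEStronglyMeasurable H (μ.prod ν)) (hG : ∀ᵐ u ∂μ, ∫ w, H (u, w) ∂ν = G u) :
    Integrable G μ ∧ ∫ ω, F ω ∂P = ∫ u, G u ∂μ := by
  have hHint : Integrable H (μ.prod ν) := (hD.integrable_comp hH).1 (hF.congr hFH)
  refine ⟨hHint.integral_prod_left.congr hG, ?_⟩
  rw [integral_congr_ae hFH, ← integral_congr_ae hG, ← integral_prod _ hHint, ← hD.map_eq,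
    integral_map hD.measurable.aemeasurable (hD.map_eq ▸ hH)]

lemma System.integrable_eval_tree (S : System d r) (hγ : ∀ k, Measurable fun t => γ t k)
    {k : Mode d} {t : ℝ} (h : Integrable (S.eval χ₀ γ t) (S.treeLaw k)) :
    Integrable (fun ω => S.eval χ₀ γ t (S.tree k ω)) S.sampleLaw :=
  (integrable_map_measure (S.measurable_eval_right hγ t).aestronglyMeasurable
    (S.measurable_tree k).aemeasurable).1 h

lemma System.integral_norm_eval_tree (S : System d r) (hγ : ∀ k, Measurable fun t => γ t k)
    (k : Mode d) (t : ℝ) :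
    ∫ ω, ‖S.eval χ₀ γ t (S.tree k ω)‖ ∂S.sampleLaw = ∫ τ, ‖S.eval χ₀ γ t τ‖ ∂(S.treeLaw k) :=
  (integral_map (S.measurable_tree k).aemeasurable
    (S.measurable_eval_right hγ t).norm.aestronglyMeasurable).symm

lemma System.integral_firstEventValue (S : System d r) (hγ : ∀ k, Measurable fun t => γ t k) {T : ℝ}
    (hint : ∀ k, ∀ t ∈ Icc 0 T, Integrable (S.eval χ₀ γ t) (S.treeLaw k)) {C : ℝ}
    (hC : ∀ k, ∀ t ∈ Icc 0 T, ∫ τ, ‖S.eval χ₀ γ t τ‖ ∂(S.treeLaw k) ≤ C) (k : Mode d) {t e : ℝ}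
    (ht : t ∈ Icc 0 T) (he : 0 ≤ e) :
    ∫ z, S.firstEventValue χ₀ γ k t (e, z) ∂((volume.restrict (Icc 0 1)).prod (S.offspringLaw k)) =
      if t ≤ (S.rate k)⁻¹ * e then χ₀ k
      else S.bracket (γ (t - (S.rate k)⁻¹ * e)) (S.mean χ₀ γ (t - (S.rate k)⁻¹ * e)) k := by
  simp only [System.firstEventValue]
  split_ifs with hte
  · simp
  · have hs : t - (S.rate k)⁻¹ * e ∈ Icc 0 T := by
      have := mul_nonneg (inv_nonneg.2 (S.rate_pos k).le) he
      exact ⟨by linarith [not_le.1 hte], by linarith [ht.2]⟩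
    rw [S.integral_offspringValue k (γ (t - (S.rate k)⁻¹ * e))
      (fun l => S.integrable_eval_tree hγ (hint l _ hs))
      (fun l => (S.measurable_eval_right hγ _).comp (S.measurable_tree l))
      (fun l => (S.integral_norm_eval_tree hγ l _).trans_le (hC l _ hs))]
    congr 1
    funext l
    exact (S.mean_eq hγ _ l).symm

/-- Conditioning on the first clock. -/
lemma System.integrable_mean_clock (S : System d r) (hγ : ∀ k, Measurable fun t => γ t k) {T : ℝ}
    (hint : ∀ k, ∀ t ∈ Icc 0 T, Integrable (S.eval χ₀ γ t) (S.treeLaw k)) {C : ℝ}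
    (hC : ∀ k, ∀ t ∈ Icc 0 T, ∫ τ, ‖S.eval χ₀ γ t τ‖ ∂(S.treeLaw k) ≤ C) (k : Mode d) {t : ℝ}
    (ht : t ∈ Icc 0 T) :
    Integrable (fun e => if t ≤ (S.rate k)⁻¹ * e then χ₀ k
      else S.bracket (γ (t - (S.rate k)⁻¹ * e)) (S.mean χ₀ γ (t - (S.rate k)⁻¹ * e)) k)
      (expMeasure 1) ∧
    S.mean χ₀ γ t k = ∫ e, (if t ≤ (S.rate k)⁻¹ * e then χ₀ k
      else S.bracket (γ (t - (S.rate k)⁻¹ * e)) (S.mean χ₀ γ (t - (S.rate k)⁻¹ * e)) k)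
      ∂(expMeasure 1) := by
  rw [S.mean_eq hγ]
  refine integral_of_measurePreserving_prod (ν := (volume.restrict (Icc 0 1)).prod (S.offspringLaw k))
    (S.measurePreserving_rootData k) (S.integrable_eval_tree hγ (hint k t ht))
    (S.ae_eval_tree_eq χ₀ γ k t) (S.measurable_firstEventValue hγ k t).aestronglyMeasurable ?_
  filter_upwards [ae_expMeasure_nonneg] with e he
  exact S.integral_firstEventValue hγ hint hC k ht he

lemma System.norm_quadTerm_le (S : System d r) (k : Mode d) {x : Mode d → Vec r} {C : ℝ}
    (hx : ∀ l, ‖x l‖ ≤ C) (lm : Mode d × Mode d) :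
    ‖S.quadTerm k x lm‖ ≤ S.q k lm.1 lm.2 * (C * C) := by
  rw [System.quadTerm, norm_smul, Real.norm_of_nonneg (S.q_nonneg _ _ _)]
  refine mul_le_mul_of_nonneg_left ((S.B_bound _ _ _ _ _).trans ?_) (S.q_nonneg _ _ _)
  exact mul_le_mul (hx _) (hx _) (norm_nonneg _) ((norm_nonneg _).trans (hx lm.1))

lemma System.summable_quadTerm (S : System d r) (k : Mode d) {x : Mode d → Vec r} {C : ℝ}
    (hx : ∀ l, ‖x l‖ ≤ C) : Summable (S.quadTerm k x) :=
  Summable.of_norm_bounded ((S.q_summable k).mul_right (C * C)) (S.norm_quadTerm_le k hx)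

/-- For a measurable forcing, the mean of the evaluation is a mild solution. -/
lemma System.isMildSolution_mean (S : System d r) (hγ : ∀ k, Measurable fun t => γ t k) {T : ℝ}
    (hint : ∀ k, ∀ t ∈ Icc 0 T, Integrable (S.eval χ₀ γ t) (S.treeLaw k)) {C : ℝ}
    (hC : ∀ k, ∀ t ∈ Icc 0 T, ∫ τ, ‖S.eval χ₀ γ t τ‖ ∂(S.treeLaw k) ≤ C) :
    IsMildSolution S T χ₀ γ (S.mean χ₀ γ) := by
  have hbound : ∀ t ∈ Icc 0 T, ∀ k, ‖S.mean χ₀ γ t k‖ ≤ C := fun t ht k =>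
    (norm_integral_le_integral_norm _).trans (hC k t ht)
  have hclock := fun k t (ht : t ∈ Icc 0 T) => S.integrable_mean_clock hγ hint hC k ht
  have hexp := fun k t (ht : t ∈ Icc 0 T) =>
    integral_exp_clock (S.rate_pos k) ht.1 (χ₀ k)
      (fun s => S.bracket (γ s) (S.mean χ₀ γ s) k) (hclock k t ht).1
  refine ⟨⟨fun k => (S.measurable_mean hγ k).aestronglyMeasurable, C, ?_⟩, fun k => ?_,
    fun k t ht => (hexp k t ht).1, fun k t ht => (hclock k t ht).2.trans (hexp k t ht).2⟩
  · filter_upwards [ae_restrict_mem measurableSet_Icc] with t ht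
    exact hbound t ht
  · filter_upwards [ae_restrict_mem measurableSet_Icc] with t ht
    exact S.summable_quadTerm k (hbound t ht)

end MeasurableForcing

/-! ### Uniqueness of mild solutions -/

/-- The forcing cancels, and $B(x,x') - B(y,y') = B(x-y,x') + B(y,x'-y')$ accounts for the factor
$2M$. The constant keeps $p_k$ and $q_k$ explicit, since their decay drives uniqueness. -/
lemma System.norm_bracket_sub_le (S : System d r) (k : Mode d) (g : Mode d → Vec r)
    {x y : Mode d → Vec r} {M D : ℝ} (hx : ∀ l, ‖x l‖ ≤ M) (hy : ∀ l, ‖y l‖ ≤ M)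
    (hxy : ∀ l, ‖x l - y l‖ ≤ D) :
    ‖S.bracket g x k - S.bracket g y k‖ ≤ (S.Cf * S.p k + S.Cb * (S.qTot k * (2 * M))) * D := by
  have hM : 0 ≤ M := (norm_nonneg _).trans (hx k)
  have hD : 0 ≤ D := (norm_nonneg _).trans (hxy k)
  have hterm : ∀ lm, ‖S.quadTerm k x lm - S.quadTerm k y lm‖ ≤
      S.q k lm.1 lm.2 * (2 * M * D) := fun lm => by
    have h : S.B k lm.1 lm.2 (x lm.1) (x lm.2) - S.B k lm.1 lm.2 (y lm.1) (y lm.2) =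
        S.B k lm.1 lm.2 (x lm.1 - y lm.1) (x lm.2) +
          S.B k lm.1 lm.2 (y lm.1) (x lm.2 - y lm.2) := by
      simp only [map_sub, LinearMap.sub_apply]
      abel
    rw [System.quadTerm, System.quadTerm, ← smul_sub, norm_smul,
      Real.norm_of_nonneg (S.q_nonneg _ _ _), h]
    refine mul_le_mul_of_nonneg_left ((norm_add_le _ _).trans ?_) (S.q_nonneg _ _ _)
    have h1 := (S.B_bound k lm.1 lm.2 (x lm.1 - y lm.1) (x lm.2)).trans
      (mul_le_mul (hxy _) (hx _) (norm_nonneg _) hD)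
    have h2 := (S.B_bound k lm.1 lm.2 (y lm.1) (x lm.2 - y lm.2)).trans
      (mul_le_mul (hy _) (hxy _) (norm_nonneg _) hM)
    linarith
  have hsum : ‖(∑' lm, S.quadTerm k x lm) - ∑' lm, S.quadTerm k y lm‖ ≤
      S.qTot k * (2 * M * D) := by
    rw [← (S.summable_quadTerm k hx).tsum_sub (S.summable_quadTerm k hy)]
    exact tsum_of_norm_bounded ((S.q_summable k).hasSum.mul_right _) hterm
  have heq : S.bracket g x k - S.bracket g y k = (S.Cf * S.p k) • (x k - y k) +
      S.Cb • ((∑' lm, S.quadTerm k x lm) - ∑' lm, S.quadTerm k y lm) := by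
    simp only [System.bracket, smul_sub]
    abel
  rw [heq]
  refine (norm_add_le _ _).trans ?_
  rw [norm_smul, norm_smul, Real.norm_of_nonneg (mul_nonneg S.Cf_nonneg (S.p_nonneg k)),
    Real.norm_of_nonneg S.Cb_nonneg]
  have h1 := mul_le_mul_of_nonneg_left (hxy k) (mul_nonneg S.Cf_nonneg (S.p_nonneg k))
  have h2 := mul_le_mul_of_nonneg_left hsum S.Cb_nonneg
  linarith

/-- A coefficient that vanishes at infinity is damped by an exponential weight, uniformly in the
rates. -/
lemma exists_weight {ι : Type*} {c a : ι → ℝ} (hc : ∀ k, 0 ≤ c k) (ha : ∀ k, 0 < a k)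
    (hlim : Tendsto c cofinite (𝓝 0)) : ∃ β : ℝ, 0 ≤ β ∧ ∀ k, c k * a k / (a k + β) ≤ 1 / 2 := by
  have hfin : {k | ¬ c k < 1 / 2}.Finite :=
    hlim.eventually (gt_mem_nhds (by norm_num : (0 : ℝ) < 1 / 2))
  have hnn : ∀ k, 0 ≤ 2 * (c k * a k) := fun k =>
    mul_nonneg zero_le_two (mul_nonneg (hc k) (ha k).le)
  have hβ : 0 ≤ ∑ k ∈ hfin.toFinset, 2 * (c k * a k) := Finset.sum_nonneg fun k _ => hnn k
  -- Where $c_k < 1/2$ any $\beta \ge 0$ works. At each of the finitely many other modes the sum is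
  -- at least its own term $2c_ka_k$, which suffices.
  refine ⟨∑ k ∈ hfin.toFinset, 2 * (c k * a k), hβ, fun k => ?_⟩
  rw [div_le_iff₀ (by linarith [ha k])]
  by_cases hk : c k < 1 / 2
  · nlinarith [ha k]
  · have := Finset.single_le_sum (f := fun k => 2 * (c k * a k)) (fun k _ => hnn k)
      (hfin.mem_toFinset.2 hk)
    linarith [ha k]

/-- The gain $a/(a+\beta)$ is the contraction that the weight $e^{\beta t}$ extracts from a kernel
of rate $a$. -/
lemma integral_exp_kernel_le {a β t : ℝ} (ha : 0 < a) (hβ : 0 ≤ β) :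
    ∫ s in (0 : ℝ)..t, a * Real.exp (-a * (t - s)) * Real.exp (β * s) ≤
      a / (a + β) * Real.exp (β * t) := by
  have hab : 0 < a + β := by linarith
  have h : ∀ s, a * Real.exp (-a * (t - s)) * Real.exp (β * s) =
      a * Real.exp (-a * t) * Real.exp ((a + β) * s) := fun s => by
    rw [mul_assoc, mul_assoc, ← Real.exp_add, ← Real.exp_add]
    ring_nf
  simp only [h]
  rw [intervalIntegral.integral_const_mul,
    intervalIntegral.integral_comp_mul_left (fun x => Real.exp x) hab.ne', integral_exp, smul_eq_mul]
  have h2 : Real.exp (β * t) = Real.exp (-a * t) * Real.exp ((a + β) * t) := by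
    rw [← Real.exp_add]
    ring_nf
  rw [h2, mul_zero, Real.exp_zero]
  -- The gap between the two sides is exactly the contribution of the lower endpoint $s = 0$, which
  -- is non-negative.
  have h3 : a / (a + β) * (Real.exp (-a * t) * Real.exp ((a + β) * t)) -
      a * Real.exp (-a * t) * ((a + β)⁻¹ * (Real.exp ((a + β) * t) - 1)) =
      a / (a + β) * Real.exp (-a * t) := by
    rw [div_eq_mul_inv]
    ring
  have h4 : 0 ≤ a / (a + β) * Real.exp (-a * t) := by positivity
  linarith

/-- Mild solutions are unique. -/
lemma IsMildSolution.unique {S : System d r} {T : ℝ} {χ₀ : Mode d → Vec r}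
    {γ η ζ : ℝ → Mode d → Vec r} (hη : IsMildSolution S T χ₀ γ η)
    (hζ : IsMildSolution S T χ₀ γ ζ) {t : ℝ} (ht : t ∈ Icc 0 T) (k : Mode d) :
    η t k = ζ t k := by
  obtain ⟨-, M₁, hM₁⟩ := hη.linfty
  obtain ⟨-, M₂, hM₂⟩ := hζ.linfty
  -- The maximum with $0$ is needed when $T = 0$: the essential bounds are then vacuous and may be
  -- negative.
  set M : ℝ := max (max M₁ M₂) 0
  have hM0 : 0 ≤ M := le_max_right _ _
  have hη' : ∀ᵐ s ∂(volume.restrict (Icc 0 T)), ∀ l, ‖η s l‖ ≤ M := hM₁.mono fun s h l =>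
    (h l).trans ((le_max_left _ _).trans (le_max_left _ _))
  have hζ' : ∀ᵐ s ∂(volume.restrict (Icc 0 T)), ∀ l, ‖ζ s l‖ ≤ M := hM₂.mono fun s h l =>
    (h l).trans ((le_max_right _ _).trans (le_max_left _ _))
  set c : Mode d → ℝ := fun k => S.Cf * S.p k + S.Cb * (S.qTot k * (2 * M))
  have hc : ∀ k, 0 ≤ c k := fun k =>
    add_nonneg (mul_nonneg S.Cf_nonneg (S.p_nonneg k))
      (mul_nonneg S.Cb_nonneg (mul_nonneg (S.qTot_nonneg k) (by linarith)))
  have hlim : Tendsto c cofinite (𝓝 0) := by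
    have := (S.p_tendsto.const_mul S.Cf).add ((S.q_tendsto.mul_const (2 * M)).const_mul S.Cb)
    rw [mul_zero, zero_mul, mul_zero, add_zero] at this
    exact this
  obtain ⟨β, hβ, hcβ⟩ := exists_weight hc S.rate_pos hlim
  -- The input is an almost everywhere bound and the output holds at every time, because the mild
  -- equation does. The last application thus gives equality everywhere on $[0,T]$.
  have step : ∀ A : ℝ, 0 ≤ A →
      (∀ᵐ s ∂(volume.restrict (Icc 0 T)), ∀ l, ‖η s l - ζ s l‖ ≤ A * Real.exp (β * s)) →
      ∀ t ∈ Icc 0 T, ∀ k, ‖η t k - ζ t k‖ ≤ A * (1 / 2) * Real.exp (β * t) := by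
    intro A hA h t ht k
    have hdiff : η t k - ζ t k = ∫ s in (0 : ℝ)..t, (S.rate k * Real.exp (-S.rate k * (t - s))) •
        (S.bracket (γ s) (η s) k - S.bracket (γ s) (ζ s) k) := by
      simp only [smul_sub]
      rw [hη.mild k t ht, hζ.mild k t ht, add_sub_add_left_eq_sub,
        intervalIntegral.integral_sub (hη.integrable k t ht) (hζ.integrable k t ht)]
    have hall := (ae_restrict_iff' measurableSet_Icc).1 (h.and (hη'.and hζ'))
    have hle : ∀ᵐ s ∂(volume : Measure ℝ), s ∈ Ioc 0 t →
        ‖(S.rate k * Real.exp (-S.rate k * (t - s))) •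
          (S.bracket (γ s) (η s) k - S.bracket (γ s) (ζ s) k)‖ ≤
        (c k * A) * (S.rate k * Real.exp (-S.rate k * (t - s)) * Real.exp (β * s)) := by
      filter_upwards [hall] with s hs hst
      obtain ⟨h1, h2, h3⟩ := hs ⟨hst.1.le, hst.2.trans ht.2⟩
      have hw : 0 ≤ S.rate k * Real.exp (-S.rate k * (t - s)) :=
        mul_nonneg (S.rate_pos k).le (Real.exp_pos _).le
      rw [norm_smul, Real.norm_of_nonneg hw]
      refine (mul_le_mul_of_nonneg_left (S.norm_bracket_sub_le k (γ s) h2 h3 h1) hw).trans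
        (le_of_eq ?_)
      simp only [c]
      ring
    rw [hdiff]
    refine (intervalIntegral.norm_integral_le_of_norm_le ht.1 hle
      (Continuous.intervalIntegrable (by fun_prop) _ _)).trans ?_
    rw [intervalIntegral.integral_const_mul]
    calc _ ≤ c k * A * (S.rate k / (S.rate k + β) * Real.exp (β * t)) :=
          mul_le_mul_of_nonneg_left (integral_exp_kernel_le (S.rate_pos k) hβ)
            (mul_nonneg (hc k) hA)
      _ = A * (c k * S.rate k / (S.rate k + β)) * Real.exp (β * t) := by ring
      _ ≤ A * (1 / 2) * Real.exp (β * t) := by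
          exact mul_le_mul_of_nonneg_right (mul_le_mul_of_nonneg_left (hcβ k) hA)
            (Real.exp_pos _).le
  have iter : ∀ n : ℕ, ∀ᵐ s ∂(volume.restrict (Icc 0 T)), ∀ l,
      ‖η s l - ζ s l‖ ≤ 2 * M * (1 / 2) ^ n * Real.exp (β * s) := by
    intro n
    induction n with
    | zero =>
      filter_upwards [hη', hζ', ae_restrict_mem measurableSet_Icc] with s h1 h2 hs l
      have h3 : ‖η s l - ζ s l‖ ≤ 2 * M := by linarith [norm_sub_le (η s l) (ζ s l), h1 l, h2 l]
      have h4 : 1 ≤ Real.exp (β * s) := Real.one_le_exp (mul_nonneg hβ hs.1)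
      rw [pow_zero, mul_one]
      nlinarith
    | succ n ih =>
      filter_upwards [ae_restrict_mem measurableSet_Icc] with s hs l
      have := step _ (by positivity) ih s hs l
      rwa [pow_succ, ← mul_assoc]
  have hzero : Tendsto (fun n : ℕ => 2 * M * (1 / 2) ^ n * (1 / 2) * Real.exp (β * t)) atTop
      (𝓝 0) := by
    have := (((tendsto_pow_atTop_nhds_zero_of_lt_one (by norm_num : (0 : ℝ) ≤ 1 / 2)
      (by norm_num)).const_mul (2 * M)).mul_const (1 / 2)).mul_const (Real.exp (β * t))
    simpa using this
  have := ge_of_tendsto' hzero fun n => step _ (by positivity) (iter n) t ht k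
  exact sub_eq_zero.1 (norm_le_zero_iff.1 this)

/-- Being a mild solution depends on the forcing only up to null sets and on the values of the
solution in `[0,T]` only. -/
lemma IsMildSolution.congr {S : System d r} {T : ℝ} {χ₀ : Mode d → Vec r}
    {γ γ' η η' : ℝ → Mode d → Vec r} (h : IsMildSolution S T χ₀ γ η)
    (hγ : ∀ᵐ s ∂(volume.restrict (Icc 0 T)), γ s = γ' s) (hη : ∀ t ∈ Icc 0 T, η t = η' t) :
    IsMildSolution S T χ₀ γ' η' := by
  have hη' : ∀ᵐ s ∂(volume.restrict (Icc 0 T)), η s = η' s := by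
    filter_upwards [ae_restrict_mem measurableSet_Icc] with s hs using hη s hs
  have hae : ∀ k, ∀ t ∈ Icc 0 T, ∀ᵐ s ∂(volume.restrict (uIoc 0 t)),
      (S.rate k * Real.exp (-S.rate k * (t - s))) • S.bracket (γ s) (η s) k =
      (S.rate k * Real.exp (-S.rate k * (t - s))) • S.bracket (γ' s) (η' s) k := by
    intro k t ht
    have hsub : uIoc 0 t ⊆ Icc 0 T := by
      rw [uIoc_of_le ht.1]
      exact fun s hs => ⟨hs.1.le, hs.2.trans ht.2⟩
    filter_upwards [ae_restrict_of_ae_restrict_of_subset hsub hγ,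
      ae_restrict_of_ae_restrict_of_subset hsub hη'] with s h1 h2
    rw [h1, h2]
  refine ⟨⟨fun k => (h.linfty.1 k).congr (hη'.mono fun s hs => congrFun hs k), ?_⟩,
    fun k => ?_, fun k t ht => (h.integrable k t ht).congr_ae (hae k t ht), fun k t ht => ?_⟩
  · obtain ⟨M, hM⟩ := h.linfty.2
    refine ⟨M, ?_⟩
    filter_upwards [hM, hη'] with s h1 h2
    rwa [← h2]
  · filter_upwards [h.summable k, hη'] with s h1 h2
    rwa [← h2]
  · rw [← hη t ht, h.mild k t ht, intervalIntegral.integral_congr_ae_restrict (hae k t ht)]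

end TreeRep

end

/-! ### The representation theorem for a general forcing -/

theorem theorem3p5 {d r : ℕ} (S : System d r) (T : ℝ) (hT : 0 ≤ T)
    (χ₀ : Mode d → Vec r) (hχ₀ : ∃ M : ℝ, ∀ k, ‖χ₀ k‖ ≤ M)
    (γ : ℝ → Mode d → Vec r) (hγ : IsLinfty T γ)
    (C : ℝ≥0)
    (hC : ∀ k, ∀ t ∈ Icc 0 T, ∫⁻ τ, ‖S.eval χ₀ γ t τ‖ₑ ∂(S.treeLaw k) ≤ C) :
    (∀ k, ∀ t ∈ Icc 0 T, Integrable (S.eval χ₀ γ t) (S.treeLaw k)) ∧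
    IsMildSolution S T χ₀ γ (fun t k => ∫ τ, S.eval χ₀ γ t τ ∂(S.treeLaw k)) ∧
    ∀ η : ℝ → Mode d → Vec r, IsMildSolution S T χ₀ γ η →
      ∀ t ∈ Icc 0 T, ∀ k, η t k = ∫ τ, S.eval χ₀ γ t τ ∂(S.treeLaw k) := by
  -- Measurability of the evaluation is available for `γ'` only; integrability and the mild equation
  -- are proved there and carried back to `γ` by almost sure equality.
  obtain ⟨γ', hγ'm, hγγ'⟩ := hγ.exists_measurable_version
  have hae : ∀ k, ∀ t ∈ Icc 0 T, S.eval χ₀ γ t =ᵐ[S.treeLaw k] S.eval χ₀ γ' t :=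
    fun k t ht => S.eval_ae_eq χ₀ hγγ' k ht.2
  have hC' : ∀ k, ∀ t ∈ Icc 0 T, ∫⁻ τ, ‖S.eval χ₀ γ' t τ‖ₑ ∂(S.treeLaw k) ≤ C := fun k t ht => by
    rw [← lintegral_congr_ae (f := fun τ => ‖S.eval χ₀ γ t τ‖ₑ)
      ((hae k t ht).mono fun τ h => by simp only [h])]
    exact hC k t ht
  have hint : ∀ k, ∀ t ∈ Icc 0 T, Integrable (S.eval χ₀ γ' t) (S.treeLaw k) := fun k t ht =>
    ⟨(S.measurable_eval_right hγ'm t).aestronglyMeasurable,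
      (hC' k t ht).trans_lt ENNReal.coe_lt_top⟩
  have hnorm : ∀ k, ∀ t ∈ Icc 0 T, ∫ τ, ‖S.eval χ₀ γ' t τ‖ ∂(S.treeLaw k) ≤ C := fun k t ht => by
    rw [integral_norm_eq_lintegral_enorm (hint k t ht).aestronglyMeasurable]
    exact ENNReal.toReal_le_coe_of_le_coe (hC' k t ht)
  have hmild : IsMildSolution S T χ₀ γ
      (fun t k => ∫ τ, S.eval χ₀ γ t τ ∂(S.treeLaw k)) :=
    (S.isMildSolution_mean hγ'm hint hnorm).congr (hγγ'.mono fun _ h => h.symm) fun t ht =>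
      funext fun k => (integral_congr_ae (hae k t ht)).symm
  exact ⟨fun k t ht => (hint k t ht).congr (hae k t ht).symm, hmild,
    fun η hη t ht k => hη.unique hmild ht k⟩
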